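/- For $1\le p<\infty$ let $\|f\|_{S^p}=\sup_{u\in\mathbb R}\{\frac1\pi\int_u^{u+\pi}|f(t)|^p\,dt\}^{1/p}$, and let $S^p$ be the class of Stepanov almost periodic functions $f:\mathbb R\to\mathbb C$ (limits of trigonometric polynomials $\sum_j c_je^{i\mu_jt}$, $\mu_j\in\mathbb R$, in this norm). For $f\in S^p$ and $\lambda\in\mathbb R$ put $A_\lambda(f)=\lim_{L\to\infty}\frac1L\int_0^Lf(t)e^{-i\lambda t}\,dt$ and $S_\gamma f(x)=\sum_{|\lambda|\le\gamma,\ A_\lambda(f)\neq0}A_\lambda(f)e^{i\lambda x}$. The Fourier exponents of $f$ are the numbers $\lambda\ge0$ with $|A_\lambda(f)|+|A_{-\lambda}(f)|>0$. For $\alpha>0$ let $\Omega_{\alpha,p}$ be the set of bounded $f\in S^p$ such that any two different positive Fourier exponents of $f$ are at distance at least $\alpha$. Let $E_\sigma(f)_{S^p}=\inf_g\|f-g\|_{S^p}$, where $g$ runs over the entire functions of exponential type at most $\sigma$ that are bounded on the real axis. Fix $x\in\mathbb R$, put $\varphi_x(t)=f(x+t)+f(x-t)-2f(x)$, and let $w_x:[0,\infty)\to[0,\infty)$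 be nondecreasing, continuous and subadditive with $w_x(0)=0$. Let $\Omega_{\alpha,1,2}(w_x)$ be the set of all $f\in\Omega_{\alpha,1}$ for which there is a constant $C$ such that, for all $\gamma,\delta>0$ and both choices of sign, $$\frac1\delta\int_0^\delta|\varphi_x(t)-\varphi_x(t\pm\gamma)|\,dt\le C\,w_x(\gamma)$$ and $$\Big\{\sum_{k=0}^{[\pi/(\alpha\delta)]}\Big(\frac1{(k+1)\delta}\int_{k\delta}^{(k+1)\delta}|\varphi_x(t)|\,dt\Big)^2\Big\}^{1/2}\le C\,w_x(\delta).$$ **Proposition.** Let $\alpha>0$, $0<q\le2$ and $f\in\Omega_{\alpha,1,2}(w_x)$. Then, for every $n=0,1,2,\dots$, $$\Big\{\frac1{n+1}\sum_{k=n}^{2n}\big|S_{\alpha k/2}f(x)-f(x)\big|^q\Big\}^{1/q}\le K\Big(w_x\Big(\frac{\pi}{n+1}\Big)+E_{\alpha n/2}(f)_{S^1}\Big),$$ where $K>0$ depends only on $\alpha$, $q$ and the constant $C$ in the definition of the class. -/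

import Mathlib

open MeasureTheory Filter Topology

noncomputable section

namespace StepanovAP

/-- The Stepanov norm `sup_u {(1/π) ∫_u^{u+π} |f(t)|^p dt}^{1/p}` (for `1 ≤ p < ∞`), with values
in `[0, ∞]`, so that an unbounded supremum or a divergent integral gives `∞`. -/
def stepanovNorm (p : ℝ) (f : ℝ → ℂ) : ENNReal :=
  ⨆ u : ℝ, (ENNReal.ofReal (1 / Real.pi) *
    ∫⁻ t in Set.Ioc u (u + Real.pi), ‖f t‖ₑ ^ p) ^ (1 / p)

/-- The trigonometric polynomial `∑_{l ∈ s} c_l e^{i l t}` with real frequencies. -/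
def trigPoly (s : Finset ℝ) (c : ℝ → ℂ) (t : ℝ) : ℂ :=
  ∑ l ∈ s, c l * Complex.exp (Complex.I * l * t)

/-- The class `S^p` of almost periodic functions in the sense of Stepanov: measurable functions
that are limits, in the Stepanov norm, of trigonometric polynomials. -/
def stepanovClass (p : ℝ) : Set (ℝ → ℂ) :=
  {f | AEStronglyMeasurable f volume ∧
    ∀ ε : ENNReal, 0 < ε → ∃ (s : Finset ℝ) (c : ℝ → ℂ),
      stepanovNorm p (fun t => f t - trigPoly s c t) < ε}

/-- The Fourier coefficient of `f` at the frequency `l`: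
`lim_{L → ∞} (1/L) ∫_0^L f(t) e^{-i l t} dt`. The limit exists for every `f` in `S^p`. -/
def bohrCoeff (f : ℝ → ℂ) (l : ℝ) : ℂ :=
  limUnder atTop (fun L : ℝ =>
    (1 / (L : ℂ)) * ∫ t in (0 : ℝ)..L, f t * Complex.exp (-(Complex.I * l * t)))

/-- The set of nonnegative Fourier exponents: those `l ≥ 0` such that the coefficient at `l` or
the coefficient at `-l` does not vanish. -/
def fourierExponents (f : ℝ → ℂ) : Set ℝ :=
  {l | 0 ≤ l ∧ (bohrCoeff f l ≠ 0 ∨ bohrCoeff f (-l) ≠ 0)}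

/-- The partial sum `∑_{|l| ≤ γ} A_l(f) e^{i l x}` of the Fourier series, the sum being over the
frequencies `l` with `A_l(f) ≠ 0`; these are finitely many in `[-γ, γ]` if the Fourier exponents
are separated. -/
def partialSum (f : ℝ → ℂ) (γ x : ℝ) : ℂ :=
  ∑ᶠ (l : ℝ) (_ : |l| ≤ γ), bohrCoeff f l * Complex.exp (Complex.I * l * x)

/-- The class `Ω_{α,p}`: bounded functions of class `S^p` such that any two different positive
Fourier exponents are at distance at least `α`. -/
def omegaClass (α p : ℝ) : Set (ℝ → ℂ) :=
  {f | f ∈ stepanovClass p ∧ (∃ M : ℝ, ∀ t, ‖f t‖ ≤ M) ∧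
    ∀ l ∈ fourierExponents f, ∀ m ∈ fourierExponents f, 0 < l → l < m → α ≤ m - l}

/-- `B_σ`: entire functions of exponential type (at most) `σ`, bounded on the real axis. -/
def entireExpType (σ : ℝ) : Set (ℂ → ℂ) :=
  {g | Differentiable ℂ g ∧
    (∀ ε : ℝ, 0 < ε → ∃ C : ℝ, ∀ z : ℂ, ‖g z‖ ≤ C * Real.exp ((σ + ε) * ‖z‖)) ∧
    ∃ M : ℝ, ∀ t : ℝ, ‖g (t : ℂ)‖ ≤ M}

/-- The best approximation `E_σ(f)_{S^p} = inf_{g ∈ B_σ} ‖f - g‖_{S^p}`; the infimum is finite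
for every bounded `f`, because `0 ∈ B_σ` for `σ ≥ 0`. -/
def bestApprox (σ p : ℝ) (f : ℝ → ℂ) : ℝ :=
  (⨅ g ∈ entireExpType σ, stepanovNorm p (fun t => f t - g (t : ℂ))).toReal

/-- The symmetric second difference `φ_x(t) = f(x+t) + f(x-t) - 2 f(x)`. -/
def secondDiff (f : ℝ → ℂ) (x t : ℝ) : ℂ := f (x + t) + f (x - t) - 2 * f x

/-- The characteristic `G_x f(δ)_{s,p}`. -/
def gabisoniya (α : ℝ) (f : ℝ → ℂ) (x s p δ : ℝ) : ℝ :=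
  (∑ k ∈ Finset.range (⌊Real.pi / (α * δ)⌋₊ + 1),
    (1 / ((k + 1) * δ) *
      ∫ t in (k * δ)..((k + 1) * δ), ‖secondDiff f x t‖ ^ p) ^ (s / p)) ^ (1 / s)

/-- Functions of modulus of continuity type on `[0, ∞)`. -/
structure IsModulusType (w : ℝ → ℝ) : Prop where
  monotone : MonotoneOn w (Set.Ici 0)
  continuous : ContinuousOn w (Set.Ici 0)
  zero : w 0 = 0
  subadditive : ∀ a b : ℝ, 0 ≤ a → 0 ≤ b → w (a + b) ≤ w a + w b

/-- The functions `f ∈ Ω_{α,p}` for which the estimates that define `Ω_{α,p,s}(w_x)` hold with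
the constant `C`. The class `Ω_{α,p,s}(w_x)` is the union of these sets over all `C`. -/
def omegaClassWith (α p s x : ℝ) (w : ℝ → ℝ) (C : ℝ) : Set (ℝ → ℂ) :=
  {f | f ∈ omegaClass α p ∧
    (∀ γ δ : ℝ, 0 < γ → 0 < δ →
      (1 / δ * ∫ t in (0 : ℝ)..δ, ‖secondDiff f x t - secondDiff f x (t + γ)‖ ^ p) ^ (1 / p)
          ≤ C * w γ ∧
      (1 / δ * ∫ t in (0 : ℝ)..δ, ‖secondDiff f x t - secondDiff f x (t - γ)‖ ^ p) ^ (1 / p)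
          ≤ C * w γ) ∧
    ∀ δ : ℝ, 0 < δ → gabisoniya α f x s p δ ≤ C * w δ}

end StepanovAP

end

namespace StepanovAP

open scoped ComplexConjugate

/-! For `n ≥ 1` the deviation `S_{αk/2} f(x) - f(x)` is an integral of `φ_x` against a kernel `(cos
at - cos bt)/t²`, whose Fourier transform is, up to a constant, the trapezoid equal to `1` on `[-a,
a]` and `0` outside `[-b, b]`. The convolution of `f` with this kernel is a multiple of the partial
sum when no Fourier exponent lies on the sloping sides. Since positive exponents are `α`-separated,
a slope of width `α/4` fits just to the left or just to the right of `αk/2`. In units of `α` this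
means `a = m/4`, `b = (m+1)/4` with `m = 2k-1` or `m = 2k` (`exists_partialSum_sub_eq`). The
identity between convolution and partial sum follows from the uniqueness theorem for uniform limits
of trigonometric polynomials (`eq_zero_of_hasMean_zero`), because convolution with a kernel decaying
like `1/(1+t²)` turns Stepanov approximation into uniform approximation.

As `k` runs through `n, ..., 2n`, the candidates for `m` run once through `2n-1, ..., 4n`, so it
suffices to bound the sum of the squares of these integrals by `O(N w(π/N)²)`, with `N = n+1` and
the variable rescaled by `α` (`sum_norm_sq_integral_le`). On `[0, π/N]` the kernel is `O(N)` and the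
mean of `φ` suffices. Beyond `π`, a translation by the half-period of the cosine produces the
differences `φ(t) - φ(t+γ)` (`norm_integral_cos_le`). On `[π/N, π]` only the mean square over `m` is
small: a large sieve inequality (`sum_norm_sq_integral_exp_le`) bounds it by the squared block
integrals of `φ(t)/t`, which is what the second condition of the class controls. Exponents `q ≤ 2`
follow from the power mean inequality.

For `n ≥ 1` the bound uses `w_x` alone. For `n = 0` the partial sum is the mean value `A_0(f)`.
Functions of exponential type zero bounded on the axis are constants, and a constant close to `f` in
the Stepanov norm is close both to `A_0(f)` and, through `φ_x`, to `f(x)`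
(`norm_bohrCoeff_zero_sub_le`). -/

/-! ### Moduli of continuity and elementary integral bounds. -/

theorem IsModulusType.nonneg {w : ℝ → ℝ} (hw : IsModulusType w) {a : ℝ} (ha : 0 ≤ a) :
    0 ≤ w a := by
  rw [← hw.zero]
  exact hw.monotone (Set.mem_Ici.2 le_rfl) (Set.mem_Ici.2 ha) ha

theorem IsModulusType.natCast_mul_le {w : ℝ → ℝ} (hw : IsModulusType w) {τ : ℝ} (hτ : 0 ≤ τ)
    (k : ℕ) : w (k * τ) ≤ k * w τ := by
  induction k with
  | zero => simp [hw.zero]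
  | succ k ih =>
    have := hw.subadditive (k * τ) τ (by positivity) hτ
    push_cast
    rw [add_mul, add_mul, one_mul, one_mul]
    linarith

theorem IsModulusType.le_natCast_mul {w : ℝ → ℝ} (hw : IsModulusType w) {a τ : ℝ} (ha : 0 ≤ a)
    (hτ : 0 ≤ τ) {k : ℕ} (h : a ≤ k * τ) : w a ≤ k * w τ :=
  (hw.monotone (Set.mem_Ici.2 ha) (Set.mem_Ici.2 (by positivity)) h).trans
    (hw.natCast_mul_le hτ k)

theorem IsModulusType.comp_mul {w : ℝ → ℝ} (hw : IsModulusType w) {b : ℝ} (hb : 0 ≤ b) :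
    IsModulusType (fun t => w (b * t)) where
  monotone := fun s hs t ht hst => hw.monotone (Set.mem_Ici.2 (mul_nonneg hb hs))
    (Set.mem_Ici.2 (mul_nonneg hb ht)) (by gcongr)
  continuous := hw.continuous.comp (by fun_prop) (fun t ht => mul_nonneg hb ht)
  zero := by simp [hw.zero]
  subadditive := fun s t hs ht => by
    rw [mul_add]; exact hw.subadditive _ _ (by positivity) (by positivity)

/-- A bounded function whose translates and block means are controlled by `C * w`. -/
structure IsControlled (φ : ℝ → ℂ) (w : ℝ → ℝ) (C : ℝ) : Prop where
  aestronglyMeasurable : AEStronglyMeasurable φ volume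
  bounded : ∃ M : ℝ, ∀ t, ‖φ t‖ ≤ M
  shift : ∀ γ D : ℝ, 0 < γ → 0 < D → ∫ t in (0 : ℝ)..D, ‖φ t - φ (t + γ)‖ ≤ C * w γ * D
  blocks : ∀ δ : ℝ, 0 < δ → ∑ k ∈ Finset.range (⌊Real.pi / δ⌋₊ + 1),
    (1 / ((k + 1) * δ) * ∫ t in (k * δ)..((k + 1) * δ), ‖φ t‖) ^ 2 ≤ (C * w δ) ^ 2

theorem integrable_smul_of_decay {φ : ℝ → ℂ} (hφ : AEStronglyMeasurable φ volume)
    {M : ℝ} (hM : ∀ t, ‖φ t‖ ≤ M) {k : ℝ → ℝ} (hk : Measurable k) {B : ℝ}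
    (hB : ∀ t, |k t| ≤ B * (1 + t ^ 2)⁻¹) : Integrable (fun t => k t • φ t) := by
  refine Integrable.mono' (integrable_inv_one_add_sq.const_mul (B * M))
    (hk.aestronglyMeasurable.smul hφ) (ae_of_all _ fun t => ?_)
  rw [norm_smul, Real.norm_eq_abs]
  calc |k t| * ‖φ t‖ ≤ (B * (1 + t ^ 2)⁻¹) * M :=
        mul_le_mul (hB t) (hM t) (norm_nonneg _) ((abs_nonneg _).trans (hB t))
    _ = _ := by ring

theorem intervalIntegrable_of_bounded {E : Type*} [NormedAddCommGroup E] {φ : ℝ → E}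
    (hφ : AEStronglyMeasurable φ volume)
    {M : ℝ} (hM : ∀ t, ‖φ t‖ ≤ M) (a b : ℝ) : IntervalIntegrable φ volume a b := by
  rw [intervalIntegrable_iff]
  exact Measure.integrableOn_of_bounded (M := M) (by simp) hφ (ae_of_all _ hM)

theorem IsControlled.intervalIntegrable_norm {φ : ℝ → ℂ} {w : ℝ → ℝ} {C : ℝ}
    (h : IsControlled φ w C) (a b : ℝ) : IntervalIntegrable (fun t => ‖φ t‖) volume a b := by
  obtain ⟨M, hM⟩ := h.bounded
  exact (intervalIntegrable_of_bounded h.aestronglyMeasurable hM a b).norm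

theorem IsControlled.block_le {φ : ℝ → ℂ} {w : ℝ → ℝ} {C : ℝ} (h : IsControlled φ w C)
    (hw : IsModulusType w) (hC : 0 ≤ C) {δ : ℝ} (hδ : 0 < δ) {k : ℕ} (hk : k * δ ≤ Real.pi) :
    ∫ t in (k * δ)..((k + 1) * δ), ‖φ t‖ ≤ C * w δ * ((k + 1) * δ) := by
  have hmem : k ∈ Finset.range (⌊Real.pi / δ⌋₊ + 1) := by
    rw [Finset.mem_range, Nat.lt_succ_iff]
    exact Nat.le_floor ((le_div_iff₀ hδ).2 hk)
  have h1 := (Finset.single_le_sum (f := fun k : ℕ =>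
    (1 / ((k + 1) * δ) * ∫ t in (k * δ)..((k + 1) * δ), ‖φ t‖) ^ 2)
    (fun i _ => sq_nonneg _) hmem).trans (h.blocks δ hδ)
  have h2 := (abs_le_of_sq_le_sq' h1 (mul_nonneg hC (hw.nonneg hδ.le))).2
  have h3 : 0 < ((k : ℝ) + 1) * δ := by positivity
  rw [one_div, inv_mul_le_iff₀ h3] at h2
  linarith

/-- The block `k = 0` is present in the sum for every `D`, even `D > π`, so the means from the
origin are controlled at all scales. -/
theorem IsControlled.mean_le {φ : ℝ → ℂ} {w : ℝ → ℝ} {C : ℝ} (h : IsControlled φ w C)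
    (hw : IsModulusType w) (hC : 0 ≤ C) {D : ℝ} (hD : 0 < D) :
    ∫ t in (0 : ℝ)..D, ‖φ t‖ ≤ C * w D * D := by
  have := h.block_le hw hC hD (k := 0) (by simpa using Real.pi_pos.le)
  simpa using this

theorem integral_Ioi_le_of_dyadic {v : ℝ → ℝ} {A a : ℝ} (ha : 0 < a) (hA : 0 ≤ A)
    (hv : IntegrableOn v (Set.Ioi a))
    (h : ∀ j : ℕ, ∫ t in (a * 2 ^ j)..(a * 2 ^ (j + 1)), v t ≤ A / 2 ^ j) :
    ∫ t in Set.Ioi a, v t ≤ 2 * A := by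
  have hlim : Tendsto (fun J : ℕ => a * (2 : ℝ) ^ J) atTop atTop :=
    (tendsto_pow_atTop_atTop_of_one_lt one_lt_two).const_mul_atTop ha
  refine le_of_tendsto (intervalIntegral_tendsto_integral_Ioi a hv hlim)
    (Eventually.of_forall fun J => ?_)
  have hsub : ∀ i : ℕ, a ≤ a * 2 ^ i := fun i =>
    le_mul_of_one_le_right ha.le (one_le_pow₀ one_le_two)
  have hsum := intervalIntegral.sum_integral_adjacent_intervals (f := v) (μ := volume)
    (a := fun j : ℕ => a * (2 : ℝ) ^ j) (n := J) (fun k _ => by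
      rw [intervalIntegrable_iff_integrableOn_Ioc_of_le (by gcongr <;> norm_num)]
      exact hv.mono_set fun t ht => lt_of_le_of_lt (hsub k) ht.1)
  simp only [pow_zero, mul_one] at hsum
  rw [← hsum]
  calc _ ≤ ∑ j ∈ Finset.range J, A / 2 ^ j := Finset.sum_le_sum fun j _ => h j
    _ = A * ∑ j ∈ Finset.range J, (1 / 2 : ℝ) ^ j := by
      rw [Finset.mul_sum]; exact Finset.sum_congr rfl fun j _ => by
        rw [one_div, inv_pow]; rfl
    _ ≤ A * 2 := by
      gcongr
      exact sum_geometric_two_le J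
    _ = _ := mul_comm _ _

/-- The weight is largest at the left end, and the integral of `u` is enlarged to start at `0`,
where the available bounds on `φ` start. -/
theorem integral_div_pow_le {u : ℝ → ℝ} (hu : ∀ t, 0 ≤ u t)
    (hi : ∀ a b, IntervalIntegrable u volume a b) {a b U : ℝ} (ha : 0 < a) (hab : a ≤ b)
    (hU : ∫ t in (0 : ℝ)..b, u t ≤ U) (p : ℕ) :
    ∫ t in a..b, u t / t ^ p ≤ U / a ^ p := by
  have hcont : ContinuousOn (fun t : ℝ => (t ^ p)⁻¹) (Set.uIcc a b) := by
    refine ContinuousOn.inv₀ (by fun_prop) fun t ht => ?_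
    rw [Set.uIcc_of_le hab] at ht
    exact pow_ne_zero _ (ha.trans_le ht.1).ne'
  have h1 : ∫ t in a..b, u t / t ^ p ≤ ∫ t in a..b, u t * (a ^ p)⁻¹ := by
    refine intervalIntegral.integral_mono_on hab ((hi a b).mul_continuousOn hcont)
      ((hi a b).mul_const _) fun t ht => ?_
    rw [div_eq_mul_inv]
    have := ht.1
    have := hu t
    gcongr
  refine h1.trans ?_
  rw [intervalIntegral.integral_mul_const, div_eq_mul_inv]
  have h2 : ∫ t in a..b, u t ≤ ∫ t in (0 : ℝ)..b, u t := by
    rw [← intervalIntegral.integral_add_adjacent_intervals (hi 0 a) (hi a b)]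
    have := intervalIntegral.integral_nonneg ha.le (fun t _ => hu t) (μ := volume)
    linarith
  gcongr
  exact h2.trans hU

theorem inv_sq_sub_inv_sq_le {t γ : ℝ} (ht : 0 < t) (hγ : 0 ≤ γ) :
    |(t ^ 2)⁻¹ - ((t + γ) ^ 2)⁻¹| ≤ 2 * γ / t ^ 3 := by
  have h : ((t + γ) ^ 2)⁻¹ ≤ (t ^ 2)⁻¹ := by gcongr; linarith
  rw [abs_of_nonneg (by linarith)]
  have h0 : 0 < t + γ := by linarith
  rw [inv_eq_one_div, inv_eq_one_div, div_sub_div _ _ (by positivity) (by positivity),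
    div_le_div_iff₀ (by positivity) (by positivity)]
  have : 2 * γ * (t ^ 2 * (t + γ) ^ 2) - (1 * (t + γ) ^ 2 - t ^ 2 * 1) * t ^ 3 =
    t ^ 2 * γ * (t * (3 * γ) + 2 * γ ^ 2) := by ring
  have : 0 ≤ t ^ 2 * γ * (t * (3 * γ) + 2 * γ ^ 2) := by positivity
  linarith

/-! ### The oscillatory integral beyond `π`. -/

namespace IsControlled

variable {φ : ℝ → ℂ} {w : ℝ → ℝ} {C : ℝ}

/-- A mean over `[0, 2π]` would only give `w` at a fixed scale. Instead the interval is placed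
inside a single block `[kD, (k+1)D]` whose length `D` is comparable with `π/N`. -/
theorem integral_after_pi_le (h : IsControlled φ w C) (hw : IsModulusType w) (hC : 0 ≤ C)
    {N m : ℕ} (hN : 1 ≤ N) (hm : 1 ≤ m) (hNm : N ≤ 2 * m) :
    ∫ t in Real.pi..(Real.pi + 4 * Real.pi / m), ‖φ t‖ ≤ 80 * Real.pi * (C * w (Real.pi / N)) := by
  have hN0 : (0 : ℝ) < N := by exact_mod_cast hN
  have hm0 : (0 : ℝ) < m := by exact_mod_cast hm
  have hπ := Real.pi_pos
  have hwδ := hw.nonneg (a := Real.pi / N) (by positivity)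
  have hγ8 : 4 * Real.pi / m ≤ 8 * (Real.pi / N) := by
    have : (N : ℝ) ≤ 2 * m := by exact_mod_cast hNm
    rw [mul_div_assoc', div_le_div_iff₀ hm0 hN0]
    nlinarith
  have hm1 : (1 : ℝ) ≤ m := by exact_mod_cast hm
  have hγ5 : 4 * Real.pi / m ≤ 4 * Real.pi := div_le_self (by positivity) hm1
  obtain ⟨k, D, hD, hkD, hlo, hhi, hD16, hk5⟩ : ∃ (k : ℕ) (D : ℝ), 0 < D ∧ k * D ≤ Real.pi ∧
      Real.pi ≤ (k + 1) * D ∧ Real.pi + 4 * Real.pi / m ≤ (k + 1) * D ∧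
      D ≤ (16 : ℕ) * (Real.pi / N) ∧ (k + 1) * D ≤ 5 * Real.pi := by
    -- For `m ≥ 4` the choice `k = m/4` (integer part), `D = π/k` starts the block exactly at `π`,
    -- with `D ≥ 4π/m`. For `m < 4` the number `N` is bounded and the block `k = 0` already has
    -- length comparable with `π/N`.
    rcases lt_or_ge m 4 with hm4 | hm4
    · refine ⟨0, Real.pi + 4 * Real.pi / m, by positivity, by simpa using hπ.le, ?_, by simp,
        ?_, by simp; linarith⟩
      · have : 0 < 4 * Real.pi / m := by positivity
        simp; linarith
      · have h8 : (N : ℝ) ≤ 8 := by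
          have : N ≤ 8 := by omega
          exact_mod_cast this
        have : Real.pi ≤ 8 * (Real.pi / N) := by
          rw [mul_div_assoc', le_div_iff₀ hN0]; nlinarith
        push_cast
        linarith
    · have hk1 : 1 ≤ m / 4 := by omega
      have hk0 : (0 : ℝ) < (m / 4 : ℕ) := by exact_mod_cast hk1
      have h4 : 4 * ((m / 4 : ℕ) : ℝ) ≤ m := by exact_mod_cast Nat.mul_div_le m 4
      have h8 : (m : ℝ) ≤ 8 * ((m / 4 : ℕ) : ℝ) := by
        have : m ≤ 8 * (m / 4) := by omega
        exact_mod_cast this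
      have hNm' : (N : ℝ) ≤ 2 * m := by exact_mod_cast hNm
      have hk1' : (1 : ℝ) ≤ (m / 4 : ℕ) := by exact_mod_cast hk1
      have e : ((m / 4 : ℕ) : ℝ) * (Real.pi / (m / 4 : ℕ)) = Real.pi := by field_simp
      have hpos : 0 < Real.pi / (m / 4 : ℕ) := by positivity
      refine ⟨m / 4, Real.pi / (m / 4 : ℕ), hpos, e.le, ?_, ?_, ?_, ?_⟩
      · rw [add_mul, e]; linarith
      · rw [add_mul, e, one_mul]
        refine add_le_add le_rfl ?_
        rw [div_le_div_iff₀ hm0 hk0]; nlinarith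
      · push_cast
        rw [mul_div_assoc', div_le_div_iff₀ hk0 hN0]; nlinarith
      · rw [add_mul, e, one_mul]
        have : Real.pi / (m / 4 : ℕ) ≤ Real.pi := div_le_self hπ.le hk1'
        linarith
  have hb := h.block_le hw hC hD hkD
  have hwD := hw.le_natCast_mul hD.le (by positivity) hD16
  have hsub : ∫ t in Real.pi..(Real.pi + 4 * Real.pi / m), ‖φ t‖ ≤
      ∫ t in (k * D)..((k + 1) * D), ‖φ t‖ :=
    intervalIntegral.integral_mono_interval hkD
      (by have : 0 < 4 * Real.pi / m := by positivity
          linarith) hhi (ae_of_all _ fun t => norm_nonneg _)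
      (h.intervalIntegrable_norm _ _)
  calc _ ≤ C * w D * ((k + 1) * D) := hsub.trans hb
    _ ≤ C * ((16 : ℕ) * w (Real.pi / N)) * (5 * Real.pi) := by gcongr
    _ = _ := by push_cast; ring

/-- The shift `γ = 4π/m` is a half-period of `cos (mt/4)`, so it changes the sign of the cosine.
Twice the integral is therefore a boundary piece over `[π, π+γ]` plus the integral of `F(t) +
F(t+γ)`, where either `φ` is differenced or the weight `1/t²` is. -/
theorem norm_integral_cos_le (h : IsControlled φ w C) (hw : IsModulusType w) (hC : 0 ≤ C)
    {N m : ℕ} (hN : 1 ≤ N) (hm : 1 ≤ m) (hNm : N ≤ 2 * m) :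
    ‖∫ t in Set.Ioi Real.pi, (Real.cos (m / 4 * t) / t ^ 2) • φ t‖ ≤
      112 * (C * w (Real.pi / N)) := by
  have hN0 : (0 : ℝ) < N := by exact_mod_cast hN
  have hm0 : (0 : ℝ) < m := by exact_mod_cast hm
  have hπ := Real.pi_pos
  set δ := Real.pi / N with hδ
  have hδ0 : 0 < δ := by positivity
  set γ := 4 * Real.pi / m with hγ
  have hγ0 : 0 < γ := by positivity
  have hwδ := hw.nonneg hδ0.le
  have hNm' : (N : ℝ) ≤ 2 * m := by exact_mod_cast hNm
  have hγ8 : γ ≤ (8 : ℕ) * δ := by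
    push_cast
    rw [hδ, hγ, mul_div_assoc', div_le_div_iff₀ hm0 hN0]
    nlinarith
  have hwγ : w γ ≤ 8 * w δ := by simpa using hw.le_natCast_mul hγ0.le hδ0.le hγ8
  -- Subadditivity loses a factor `N` in passing from `w π` to `w δ`, and `γ ≤ 8π/N` compensates for
  -- it.
  have hγw : γ * w Real.pi ≤ 8 * Real.pi * w δ := by
    have h1 : w Real.pi ≤ N * w δ :=
      hw.le_natCast_mul hπ.le hδ0.le (by rw [hδ]; field_simp; exact le_rfl)
    have h2 : γ * N ≤ 8 * Real.pi := by
      rw [hγ, div_mul_eq_mul_div, div_le_iff₀ hm0]; nlinarith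
    calc _ ≤ γ * (N * w δ) := by gcongr
      _ = γ * N * w δ := by ring
      _ ≤ _ := by gcongr
  obtain ⟨M, hM⟩ := h.bounded
  have hφγ : AEStronglyMeasurable (fun t => φ (t + γ)) volume :=
    h.aestronglyMeasurable.comp_measurePreserving (measurePreserving_add_right volume γ)
  have hmeasd : AEStronglyMeasurable (fun t => φ t - φ (t + γ)) volume :=
    h.aestronglyMeasurable.sub hφγ
  have hMd : ∀ t, ‖φ t - φ (t + γ)‖ ≤ M + M := fun t =>
    (norm_sub_le _ _).trans (add_le_add (hM _) (hM _))
  -- integrability of bounded functions against an inverse power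
  have hint : ∀ {g : ℝ → ℂ}, AEStronglyMeasurable g volume → ∀ {B : ℝ}, (∀ t, ‖g t‖ ≤ B) →
      ∀ {k : ℝ → ℝ}, Measurable k → ∀ p : ℕ, 2 ≤ p → (∀ t, |k t| ≤ 1) →
      IntegrableOn (fun t => (k t / t ^ p) • g t) (Set.Ioi Real.pi) := by
    intro g hg B hB k hk p hp hk1
    have hb : IntegrableOn (fun t : ℝ => B * (2 * (1 + t ^ 2)⁻¹)) (Set.Ioi Real.pi) :=
      ((integrable_inv_one_add_sq.const_mul 2).const_mul B).integrableOn
    refine hb.mono' ((hk.div (by fun_prop)).aestronglyMeasurable.smul hg.restrict) ?_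
    filter_upwards [ae_restrict_mem measurableSet_Ioi] with t ht
    have ht3 : 1 ≤ t := by linarith [Real.pi_gt_three, Set.mem_Ioi.1 ht]
    rw [norm_smul, mul_comm]
    refine mul_le_mul (hB t) ?_ (norm_nonneg _) ((norm_nonneg _).trans (hB t))
    rw [norm_div, Real.norm_eq_abs, norm_pow, Real.norm_eq_abs, abs_of_nonneg (by linarith : 0 ≤ t)]
    calc |k t| / t ^ p ≤ 1 / t ^ 2 := by
          gcongr
          exact hk1 t
      _ ≤ 2 * (1 + t ^ 2)⁻¹ := by
          rw [← div_eq_mul_inv, div_le_div_iff₀ (by positivity) (by positivity)]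
          nlinarith
  have hone : ∀ t : ℝ, |(1 : ℝ)| ≤ 1 := fun _ => by simp
  have hi1 : IntegrableOn (fun t => ‖φ t - φ (t + γ)‖ / t ^ 2) (Set.Ioi Real.pi) := by
    refine IntegrableOn.congr_fun (hint hmeasd hMd measurable_const 2 le_rfl hone).norm
      (fun t ht => ?_) measurableSet_Ioi
    have ht0 : 0 < t := hπ.trans ht
    simp only [norm_smul, norm_div, norm_one, norm_pow, Real.norm_eq_abs, abs_of_pos ht0]
    ring
  have hi2 : IntegrableOn (fun t => 2 * γ * (‖φ t‖ / t ^ 3)) (Set.Ioi Real.pi) := by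
    refine Integrable.const_mul (IntegrableOn.congr_fun (hint h.aestronglyMeasurable hM
      measurable_const 3 (by norm_num) hone).norm (fun t ht => ?_) measurableSet_Ioi) _
    have ht0 : 0 < t := hπ.trans ht
    simp only [norm_smul, norm_div, norm_one, norm_pow, Real.norm_eq_abs, abs_of_pos ht0]
    ring
  have hb1 : ∫ t in Set.Ioi Real.pi, ‖φ t - φ (t + γ)‖ / t ^ 2 ≤ 2 * (8 * (C * w δ)) := by
    refine integral_Ioi_le_of_dyadic hπ (by positivity) hi1 fun j => ?_
    refine (integral_div_pow_le (fun t => norm_nonneg _)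
      (fun a b => (intervalIntegrable_of_bounded hmeasd hMd a b).norm) (by positivity)
      (by gcongr <;> norm_num) (h.shift γ (Real.pi * 2 ^ (j + 1)) hγ0 (by positivity)) 2).trans ?_
    have hp : (1 : ℝ) ≤ 2 ^ j := one_le_pow₀ one_le_two
    rw [div_le_div_iff₀ (by positivity) (by positivity)]
    calc C * w γ * (Real.pi * 2 ^ (j + 1)) * 2 ^ j
        = C * w γ * (2 * Real.pi) * (2 ^ j) ^ 2 := by ring
      _ ≤ C * (8 * w δ) * (Real.pi * Real.pi) * (2 ^ j) ^ 2 := by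
          gcongr
          linarith [Real.pi_gt_three]
      _ = _ := by ring
  have hb2 : ∫ t in Set.Ioi Real.pi, 2 * γ * (‖φ t‖ / t ^ 3) ≤ 2 * (64 * (C * w δ)) := by
    refine integral_Ioi_le_of_dyadic hπ (by positivity) hi2 fun j => ?_
    rw [intervalIntegral.integral_const_mul]
    -- On the dyadic interval, `φ` is bounded only with `w(π 2^(j+1))`, which may grow like `2^j`.
    -- The cubic weight still leaves a factor `2^(-j)`.
    have hwj : w (Real.pi * 2 ^ (j + 1)) ≤ 2 ^ (j + 1) * w Real.pi := by
      have := hw.natCast_mul_le hπ.le (2 ^ (j + 1))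
      push_cast at this
      rwa [mul_comm (Real.pi)]
    have hm := integral_div_pow_le (fun t => norm_nonneg (φ t)) h.intervalIntegrable_norm
      (a := Real.pi * 2 ^ j) (b := Real.pi * 2 ^ (j + 1)) (by positivity)
      (by gcongr <;> norm_num) (h.mean_le hw hC (by positivity)) 3
    calc _ ≤ 2 * γ * (C * (2 ^ (j + 1) * w Real.pi) * (Real.pi * 2 ^ (j + 1)) /
              (Real.pi * 2 ^ j) ^ 3) := by
          gcongr
          refine hm.trans ?_
          gcongr
      _ = (8 / Real.pi ^ 2) * C * (γ * w Real.pi) / 2 ^ j := by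
          field_simp
          ring
      _ ≤ (8 / Real.pi ^ 2) * C * (8 * Real.pi * w δ) / 2 ^ j := by gcongr
      _ = 64 / Real.pi * (C * w δ) / 2 ^ j := by field_simp; ring
      _ ≤ 64 * (C * w δ) / 2 ^ j := by
          gcongr
          exact div_le_self (by norm_num) (by linarith [Real.pi_gt_three])
  set F : ℝ → ℂ := fun t => (Real.cos (m / 4 * t) / t ^ 2) • φ t with hF
  have hFi : IntegrableOn F (Set.Ioi Real.pi) :=
    hint h.aestronglyMeasurable hM (k := fun t => Real.cos (m / 4 * t)) (by fun_prop) 2 le_rfl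
      (fun t => Real.abs_cos_le_one _)
  have hFγ : ∀ t, F (t + γ) = -((Real.cos (m / 4 * t) / (t + γ) ^ 2) • φ (t + γ)) := fun t => by
    have : (m : ℝ) / 4 * (t + γ) = m / 4 * t + Real.pi := by rw [hγ]; field_simp
    simp only [hF, this, Real.cos_add_pi, neg_div, neg_smul]
  have himg : (fun t => t + γ) ⁻¹' Set.Ioi (Real.pi + γ) = Set.Ioi Real.pi := by
    ext t; simp
  have hFγi : IntegrableOn (fun t => F (t + γ)) (Set.Ioi Real.pi) := by
    have := (measurePreserving_add_right volume γ).integrableOn_comp_preimage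
      (measurableEmbedding_addRight γ) (f := F) (s := Set.Ioi (Real.pi + γ))
    rw [himg] at this
    exact this.2 (hFi.mono_set (Set.Ioi_subset_Ioi (by linarith)))
  have hshift : ∫ t in Set.Ioi Real.pi, F (t + γ) = ∫ t in Set.Ioi (Real.pi + γ), F t := by
    have := (measurePreserving_add_right volume γ).setIntegral_preimage_emb
      (measurableEmbedding_addRight γ) F (Set.Ioi (Real.pi + γ))
    rwa [himg] at this
  have hsplit : (∫ t in Real.pi..(Real.pi + γ), F t) + ∫ t in Set.Ioi (Real.pi + γ), F t =
      ∫ t in Set.Ioi Real.pi, F t :=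
    intervalIntegral.integral_interval_add_Ioi hFi
      (hFi.mono_set (Set.Ioi_subset_Ioi (by linarith)))
  have hkey : (2 : ℂ) * ∫ t in Set.Ioi Real.pi, F t =
      (∫ t in Real.pi..(Real.pi + γ), F t) + ∫ t in Set.Ioi Real.pi, (F t + F (t + γ)) := by
    rw [integral_add hFi hFγi, hshift, ← hsplit]; ring
  have hsum : ‖∫ t in Set.Ioi Real.pi, (F t + F (t + γ))‖ ≤
      2 * (8 * (C * w δ)) + 2 * (64 * (C * w δ)) := by
    refine le_trans ?_ (add_le_add hb1 hb2)
    rw [← integral_add hi1 hi2]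
    refine norm_integral_le_of_norm_le (hi1.add hi2) ?_
    filter_upwards [ae_restrict_mem measurableSet_Ioi] with t ht
    have ht0 : 0 < t := hπ.trans ht
    have e : F t + F (t + γ) = Real.cos (m / 4 * t) •
        (((t + γ) ^ 2)⁻¹ • (φ t - φ (t + γ)) + ((t ^ 2)⁻¹ - ((t + γ) ^ 2)⁻¹) • φ t) := by
      rw [hFγ]
      simp only [hF, div_eq_mul_inv, mul_smul, smul_add, smul_sub, sub_smul]
      abel
    rw [e, norm_smul]
    calc _ ≤ 1 * ‖((t + γ) ^ 2)⁻¹ • (φ t - φ (t + γ)) + ((t ^ 2)⁻¹ - ((t + γ) ^ 2)⁻¹) • φ t‖ := by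
          gcongr; exact Real.abs_cos_le_one _
      _ ≤ ‖((t + γ) ^ 2)⁻¹ • (φ t - φ (t + γ))‖ + ‖((t ^ 2)⁻¹ - ((t + γ) ^ 2)⁻¹) • φ t‖ := by
          rw [one_mul]; exact norm_add_le _ _
      _ ≤ ‖φ t - φ (t + γ)‖ / t ^ 2 + 2 * γ * (‖φ t‖ / t ^ 3) := by
          rw [norm_smul, norm_smul, Real.norm_eq_abs, Real.norm_eq_abs]
          have h1 := inv_sq_sub_inv_sq_le ht0 hγ0.le
          have h2 : |((t + γ) ^ 2)⁻¹| ≤ (t ^ 2)⁻¹ := by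
            rw [abs_of_nonneg (by positivity)]; gcongr; linarith
          calc _ ≤ (t ^ 2)⁻¹ * ‖φ t - φ (t + γ)‖ + 2 * γ / t ^ 3 * ‖φ t‖ := by gcongr
            _ = _ := by ring
  have hbd : ‖∫ t in Real.pi..(Real.pi + γ), F t‖ ≤ 80 * (C * w δ) := by
    calc _ ≤ ∫ t in Real.pi..(Real.pi + γ), ‖φ t‖ * Real.pi⁻¹ := by
          refine intervalIntegral.norm_integral_le_of_norm_le (by linarith) (ae_of_all _ ?_)
            ((h.intervalIntegrable_norm _ _).mul_const _)
          intro t ht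
          have ht0 : 0 < t := hπ.trans ht.1
          rw [hF, norm_smul, mul_comm]
          gcongr
          rw [norm_div, norm_pow, Real.norm_eq_abs, Real.norm_eq_abs, abs_of_pos ht0]
          calc _ ≤ 1 / t ^ 2 := by gcongr; exact Real.abs_cos_le_one _
            _ ≤ 1 / Real.pi := by
              gcongr
              have := ht.1
              nlinarith [Real.pi_gt_three]
            _ = _ := one_div _
      _ ≤ (80 * Real.pi * (C * w δ)) * Real.pi⁻¹ := by
          rw [intervalIntegral.integral_mul_const]
          gcongr
          exact h.integral_after_pi_le hw hC hN hm hNm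
      _ = _ := by field_simp
  have hfin : ‖(2 : ℂ) * ∫ t in Set.Ioi Real.pi, F t‖ ≤
      80 * (C * w δ) + (2 * (8 * (C * w δ)) + 2 * (64 * (C * w δ))) := by
    rw [hkey]
    exact (norm_add_le _ _).trans (add_le_add hbd hsum)
  rw [norm_mul] at hfin
  norm_num at hfin
  linarith

end IsControlled

/-! ### A large sieve inequality. -/

/-- Expanding the product gives a double integral over `A × B` with kernel `∑ e_κ(s) conj (e_κ(t))`.
It measures the correlation of two blocks in terms of their distance. -/
theorem norm_sum_integral_mul_conj_le {ι : Type*} (S : Finset ι) {e : ι → ℝ → ℂ}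
    (hec : ∀ κ, Continuous (e κ)) (he1 : ∀ κ t, ‖e κ t‖ ≤ 1) {g : ℝ → ℂ} {A B : Set ℝ}
    (hA : MeasurableSet A) (hB : MeasurableSet B) (hgA : IntegrableOn g A)
    (hgB : IntegrableOn g B) {K : ℝ}
    (hK : ∀ s ∈ A, ∀ t ∈ B, ‖∑ κ ∈ S, e κ s * conj (e κ t)‖ ≤ K) :
    ‖∑ κ ∈ S, (∫ t in A, e κ t * g t) * conj (∫ t in B, e κ t * g t)‖ ≤
      K * ((∫ t in A, ‖g t‖) * ∫ t in B, ‖g t‖) := by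
  have hiA : ∀ κ, IntegrableOn (fun t => e κ t * g t) A := fun κ =>
    hgA.bdd_mul (hec κ).aestronglyMeasurable (ae_of_all _ (he1 κ))
  have hiB : ∀ κ, IntegrableOn (fun t => conj (e κ t) * conj (g t)) B := fun κ => by
    have h1 : Integrable (fun t => conj (g t)) (volume.restrict B) :=
      (LinearIsometryEquiv.integrable_comp_iff Complex.conjLIE).2 hgB
    refine Integrable.bdd_mul h1 (c := 1) (Complex.continuous_conj.comp
      (hec κ)).aestronglyMeasurable (ae_of_all _ fun t => ?_)
    simpa using he1 κ t
  have hX : ∀ s, ∑ κ ∈ S, e κ s * conj (∫ t in B, e κ t * g t) =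
      ∫ t in B, (∑ κ ∈ S, e κ s * conj (e κ t)) * conj (g t) := fun s => by
    simp_rw [Finset.sum_mul]
    rw [integral_finsetSum _ fun κ _ => by
      simpa only [mul_assoc] using (hiB κ).const_mul (e κ s)]
    refine Finset.sum_congr rfl fun κ _ => ?_
    rw [← integral_conj, ← integral_const_mul]
    simp only [map_mul, mul_assoc]
  have hY : ∑ κ ∈ S, (∫ t in A, e κ t * g t) * conj (∫ t in B, e κ t * g t) =
      ∫ s in A, (∑ κ ∈ S, e κ s * conj (∫ t in B, e κ t * g t)) * g s := by
    simp_rw [Finset.sum_mul]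
    rw [integral_finsetSum _ fun κ _ => by
      simpa only [mul_right_comm] using (hiA κ).mul_const (conj (∫ t in B, e κ t * g t))]
    refine Finset.sum_congr rfl fun κ _ => ?_
    rw [← integral_mul_const]
    simp only [mul_right_comm]
  rw [hY]
  calc _ ≤ ∫ s in A, (K * ∫ t in B, ‖g t‖) * ‖g s‖ := by
        refine norm_integral_le_of_norm_le (hgA.norm.const_mul _) ?_
        filter_upwards [ae_restrict_mem hA] with s hs
        rw [norm_mul, hX]
        gcongr
        rw [← integral_const_mul]
        refine norm_integral_le_of_norm_le (hgB.norm.const_mul _) ?_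
        filter_upwards [ae_restrict_mem hB] with t ht
        rw [norm_mul, RCLike.norm_conj]
        gcongr
        exact hK s hs t ht
    _ = _ := by rw [integral_const_mul]; ring

theorem norm_sum_exp_le_card (M : ℕ) (u : ℝ) :
    ‖∑ a ∈ Finset.range M, Complex.exp (Complex.I * ((a / 4 * u : ℝ) : ℂ))‖ ≤ M := by
  refine (norm_sum_le _ _).trans ?_
  simp only [Complex.norm_exp_I_mul_ofReal]
  simp

/-- The geometric sum times `z - 1` has norm at most `2`, and `|z - 1| = 2 |sin (u/8)| ≥ |u|/(2π)`
by Jordan's inequality, which applies because `|u|/8 ≤ π/2`. -/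
theorem norm_sum_exp_le_div (M : ℕ) {u : ℝ} (hu : u ≠ 0) (hu4 : |u| ≤ 4 * Real.pi) :
    ‖∑ a ∈ Finset.range M, Complex.exp (Complex.I * ((a / 4 * u : ℝ) : ℂ))‖ ≤
      4 * Real.pi / |u| := by
  have hπ := Real.pi_pos
  set z : ℂ := Complex.exp (Complex.I * ((u / 4 : ℝ) : ℂ)) with hz
  have hpow : ∀ a : ℕ, Complex.exp (Complex.I * ((a / 4 * u : ℝ) : ℂ)) = z ^ a := fun a => by
    rw [hz, ← Complex.exp_nat_mul]
    congr 1
    push_cast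
    ring
  simp_rw [hpow]
  have hz1 : ‖z‖ = 1 := Complex.norm_exp_I_mul_ofReal _
  have hgeom := mul_geom_sum z M
  have hn : ‖z - 1‖ * ‖∑ a ∈ Finset.range M, z ^ a‖ ≤ 2 := by
    rw [← norm_mul, hgeom]
    refine (norm_sub_le _ _).trans ?_
    rw [norm_pow, hz1]
    norm_num
  have hlow : |u| / (2 * Real.pi) ≤ ‖z - 1‖ := by
    rw [hz, Complex.norm_exp_I_mul_ofReal_sub_one, Real.norm_eq_abs, abs_mul]
    have h1 : |Real.sin (u / 4 / 2)| = Real.sin (|u| / 8) := by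
      rw [show u / 4 / 2 = u / 8 by ring]
      rcases abs_cases u with ⟨h, _⟩ | ⟨h, _⟩
      · rw [h, abs_of_nonneg]
        exact Real.sin_nonneg_of_nonneg_of_le_pi (by linarith [abs_nonneg u]) (by linarith)
      · rw [h, neg_div, Real.sin_neg, abs_of_nonpos]
        exact Real.sin_nonpos_of_nonpos_of_neg_pi_le (by linarith) (by linarith)
    rw [h1]
    have h2 := Real.mul_le_sin (x := |u| / 8) (by positivity) (by linarith)
    rw [abs_of_pos (by norm_num : (0 : ℝ) < 2)]
    calc |u| / (2 * Real.pi) = 2 * (2 / Real.pi * (|u| / 8)) := by field_simp; ring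
      _ ≤ _ := by gcongr
  have hu0 : 0 < |u| := abs_pos.2 hu
  rw [le_div_iff₀ hu0]
  have := (mul_le_mul_of_nonneg_right hlow (norm_nonneg (∑ a ∈ Finset.range M, z ^ a))).trans hn
  rw [div_mul_eq_mul_div, div_le_iff₀ (by positivity)] at this
  linarith

/-- Telescoping: the term at `n + 1` is at most `2/(n+1) - 2/(n+2)`. -/
theorem sum_inv_one_add_sq_le (n : ℕ) :
    ∑ d ∈ Finset.range n, 1 / (1 + (d : ℝ) ^ 2) ≤ 3 := by
  have h : ∀ n : ℕ, ∑ d ∈ Finset.range (n + 1), 1 / (1 + (d : ℝ) ^ 2) ≤ 3 - 2 / ((n : ℝ) + 1) := by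
    intro n
    induction n with
    | zero => norm_num
    | succ n ih =>
      rw [Finset.sum_range_succ]
      have : 1 / (1 + ((n + 1 : ℕ) : ℝ) ^ 2) ≤ 2 / (n + 1) - 2 / ((n + 1 : ℕ) + 1) := by
        push_cast
        rw [div_sub_div _ _ (by positivity) (by positivity),
          div_le_div_iff₀ (by positivity) (by positivity)]
        have : (0 : ℝ) ≤ n := n.cast_nonneg
        nlinarith
      linarith
  cases n with
  | zero => norm_num
  | succ n =>
    refine (h n).trans ?_
    have : (0 : ℝ) ≤ 2 / ((n : ℝ) + 1) := by positivity
    linarith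

theorem sum_inv_one_add_sub_sq_le (s : Finset ℕ) (i : ℕ) :
    ∑ j ∈ s, 1 / (1 + ((i : ℝ) - j) ^ 2) ≤ 6 := by
  set N := s.sup id + 1
  have hsub : s ⊆ Finset.range (i + 1) ∪ Finset.Ico i (i + N) := fun j hj => by
    have : j ≤ s.sup id := Finset.le_sup (f := id) hj
    simp only [Finset.mem_union, Finset.mem_range, Finset.mem_Ico, N]
    omega
  have hpos : ∀ j : ℕ, 0 ≤ 1 / (1 + ((i : ℝ) - j) ^ 2) := fun j => by positivity
  have h1 : ∑ j ∈ Finset.range (i + 1), 1 / (1 + ((i : ℝ) - j) ^ 2) ≤ 3 := by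
    refine le_trans (le_of_eq ?_) (sum_inv_one_add_sq_le (i + 1))
    rw [← Finset.sum_range_reflect]
    refine Finset.sum_congr rfl fun j hj => ?_
    have hj' := Finset.mem_range.1 hj
    rw [show i + 1 - 1 - j = i - j by omega, Nat.cast_sub (by omega)]
    ring
  have h2 : ∑ j ∈ Finset.Ico i (i + N), 1 / (1 + ((i : ℝ) - j) ^ 2) ≤ 3 := by
    refine le_trans (le_of_eq ?_) (sum_inv_one_add_sq_le N)
    rw [Finset.sum_Ico_eq_sum_range, Nat.add_sub_cancel_left]
    refine Finset.sum_congr rfl fun j _ => ?_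
    push_cast
    ring
  have h3 := Finset.sum_union_inter (s₁ := Finset.range (i + 1)) (s₂ := Finset.Ico i (i + N))
    (f := fun j : ℕ => 1 / (1 + ((i : ℝ) - j) ^ 2))
  have h4 := Finset.sum_nonneg (s := Finset.range (i + 1) ∩ Finset.Ico i (i + N))
    fun j _ => hpos j
  have h5 := Finset.sum_le_sum_of_subset_of_nonneg hsub fun j _ _ => hpos j
  linarith

/-- Schur's test: `a_i a_j ≤ (a_i² + a_j²)/2`, and every row and column of the matrix sums to at
most `6`. -/
theorem sum_mul_inv_one_add_sub_sq_le (s : Finset ℕ) (a : ℕ → ℝ) :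
    ∑ i ∈ s, ∑ j ∈ s, a i * a j * (1 / (1 + ((i : ℝ) - j) ^ 2)) ≤ 6 * ∑ i ∈ s, a i ^ 2 := by
  have h1 : ∀ i j : ℕ, a i * a j * (1 / (1 + ((i : ℝ) - j) ^ 2)) ≤
      a i ^ 2 / 2 * (1 / (1 + ((i : ℝ) - j) ^ 2)) +
        a j ^ 2 / 2 * (1 / (1 + ((j : ℝ) - i) ^ 2)) := fun i j => by
    rw [show ((j : ℝ) - i) ^ 2 = ((i : ℝ) - j) ^ 2 by ring, ← add_mul]
    gcongr
    nlinarith [sq_nonneg (a i - a j)]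
  have h2 : ∑ i ∈ s, ∑ j ∈ s, a i ^ 2 / 2 * (1 / (1 + ((i : ℝ) - j) ^ 2)) ≤
      3 * ∑ i ∈ s, a i ^ 2 := by
    rw [Finset.mul_sum]
    refine Finset.sum_le_sum fun i _ => ?_
    rw [← Finset.mul_sum]
    have := sum_inv_one_add_sub_sq_le s i
    nlinarith [sq_nonneg (a i)]
  calc _ ≤ ∑ i ∈ s, ∑ j ∈ s, (a i ^ 2 / 2 * (1 / (1 + ((i : ℝ) - j) ^ 2)) +
        a j ^ 2 / 2 * (1 / (1 + ((j : ℝ) - i) ^ 2))) :=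
        Finset.sum_le_sum fun i _ => Finset.sum_le_sum fun j _ => h1 i j
    _ = ∑ i ∈ s, ∑ j ∈ s, a i ^ 2 / 2 * (1 / (1 + ((i : ℝ) - j) ^ 2)) +
        ∑ j ∈ s, ∑ i ∈ s, a j ^ 2 / 2 * (1 / (1 + ((j : ℝ) - i) ^ 2)) := by
        simp_rw [Finset.sum_add_distrib]
        congr 1
        exact Finset.sum_comm
    _ ≤ _ := by linarith

/-- A large sieve inequality with the `ℓ²` norm of the block integrals on the right. -/
theorem sum_norm_sq_integral_exp_le {g : ℝ → ℂ} {N : ℕ} (hN : 1 ≤ N)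
    (hg : ∀ j ∈ Finset.Ico 1 N, IntervalIntegrable g volume
      (j * (Real.pi / N)) ((j + 1) * (Real.pi / N))) (m₀ : ℝ) :
    ∑ d ∈ Finset.range (2 * N), ‖∫ t in (Real.pi / N)..Real.pi,
        Complex.exp (Complex.I * (((m₀ + d) / 4 * t : ℝ) : ℂ)) * g t‖ ^ 2 ≤
      400 * N * ∑ j ∈ Finset.Ico 1 N,
        (∫ t in (j * (Real.pi / N))..((j + 1) * (Real.pi / N)), ‖g t‖) ^ 2 := by
  have hN0 : (0 : ℝ) < N := by exact_mod_cast hN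
  have hπ := Real.pi_pos
  set δ := Real.pi / N with hδ
  have hδ0 : 0 < δ := by positivity
  have hNδ : N * δ = Real.pi := by rw [hδ]; field_simp
  set L := 2 * N with hL
  set G : ℝ → ℂ := fun μ => ∫ t in δ..Real.pi,
    Complex.exp (Complex.I * ((μ / 4 * t : ℝ) : ℂ)) * g t with hG
  set I : ℕ → Set ℝ := fun j => Set.Ioc (j * δ) ((j + 1) * δ) with hI
  have hjle : ∀ j : ℕ, (j : ℝ) * δ ≤ (j + 1) * δ := fun j => by nlinarith
  have hgI : ∀ j ∈ Finset.Ico 1 N, IntegrableOn g (I j) := fun j hj =>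
    (intervalIntegrable_iff_integrableOn_Ioc_of_le (hjle j)).1 (hg j hj)
  have hec : ∀ μ : ℝ, Continuous fun t : ℝ => Complex.exp (Complex.I * ((μ / 4 * t : ℝ) : ℂ)) :=
    fun μ => by fun_prop
  have he1 : ∀ μ t : ℝ, ‖Complex.exp (Complex.I * ((μ / 4 * t : ℝ) : ℂ))‖ ≤ 1 := fun μ t =>
    (Complex.norm_exp_I_mul_ofReal _).le
  set a : ℕ → ℝ := fun j => ∫ t in I j, ‖g t‖ with ha
  have hGsum : ∀ μ, G μ = ∑ j ∈ Finset.Ico 1 N, ∫ t in I j,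
      Complex.exp (Complex.I * ((μ / 4 * t : ℝ) : ℂ)) * g t := fun μ => by
    have := intervalIntegral.sum_integral_adjacent_intervals_Ico (μ := volume)
      (f := fun t => Complex.exp (Complex.I * ((μ / 4 * t : ℝ) : ℂ)) * g t)
      (a := fun j : ℕ => (j : ℝ) * δ) (m := 1) (n := N) hN (fun k hk => by
        have := hg k (by simpa using hk)
        simp only [Nat.cast_add, Nat.cast_one]
        exact this.continuousOn_mul (hec μ).continuousOn)
    simp only [Nat.cast_add, Nat.cast_one] at this
    rw [one_mul, hNδ] at this
    rw [hG]
    simp only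
    rw [← this]
    refine Finset.sum_congr rfl fun j _ => ?_
    rw [intervalIntegral.integral_of_le (hjle j)]
  -- Summing over the frequencies `m₀ + d` directly gives a kernel decaying only like `1/|i-j|`,
  -- which is not summable. Indexing by pairs `(b, c)` with frequency `m₀ + c - b` weights the
  -- frequencies so that the kernel factors into two geometric sums and decays like `1/|i-j|²`.
  set S := Finset.range L ×ˢ Finset.range (2 * L) with hS
  set ν : ℕ × ℕ → ℝ := fun κ => m₀ + κ.2 - κ.1 with hν
  have hker : ∀ i ∈ Finset.Ico 1 N, ∀ j ∈ Finset.Ico 1 N, ∀ s ∈ I i, ∀ t ∈ I j,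
      ‖∑ κ ∈ S, Complex.exp (Complex.I * ((ν κ / 4 * s : ℝ) : ℂ)) *
        conj (Complex.exp (Complex.I * ((ν κ / 4 * t : ℝ) : ℂ)))‖ ≤
      32 * L ^ 2 * (1 / (1 + ((i : ℝ) - j) ^ 2)) := by
    intro i hi j hj s hs t ht
    have hfac : ∑ κ ∈ S, Complex.exp (Complex.I * ((ν κ / 4 * s : ℝ) : ℂ)) *
        conj (Complex.exp (Complex.I * ((ν κ / 4 * t : ℝ) : ℂ))) =
        Complex.exp (Complex.I * ((m₀ / 4 * (s - t) : ℝ) : ℂ)) *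
        ((∑ b ∈ Finset.range L, Complex.exp (Complex.I * ((b / 4 * (t - s) : ℝ) : ℂ))) *
        ∑ c ∈ Finset.range (2 * L),
          Complex.exp (Complex.I * ((c / 4 * (s - t) : ℝ) : ℂ))) := by
      rw [Finset.sum_mul_sum, ← Finset.sum_product', Finset.mul_sum]
      refine Finset.sum_congr rfl fun κ _ => ?_
      rw [← Complex.exp_conj, ← Complex.exp_add, ← Complex.exp_add, ← Complex.exp_add]
      congr 1
      simp only [hν, map_mul, Complex.conj_I, Complex.conj_ofReal]
      push_cast
      ring
    rw [hfac, norm_mul, Complex.norm_exp_I_mul_ofReal, one_mul, norm_mul]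
    have hL0 : (L : ℝ) = 2 * N := by rw [hL]; push_cast; ring
    -- Equal or adjacent blocks contain arbitrarily close points, so only the trivial bound is
    -- available. Otherwise `|s - t| ≥ |i - j| δ / 2`.
    by_cases hij : |(i : ℝ) - j| ≤ 1
    · have h1 := norm_sum_exp_le_card L (t - s)
      have h2 := norm_sum_exp_le_card (2 * L) (s - t)
      have h3 : ((i : ℝ) - j) ^ 2 ≤ 1 := by rwa [sq_le_one_iff_abs_le_one]
      calc _ ≤ (L : ℝ) * (2 * L : ℕ) := by gcongr
        _ = 32 * L ^ 2 * (1 / 16) := by push_cast; ring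
        _ ≤ _ := by gcongr; linarith
    · have hij2 : 2 ≤ |(i : ℝ) - j| := by
        rw [not_le] at hij
        have h1 : (1 : ℤ) < |(i : ℤ) - j| := by exact_mod_cast hij
        have h2 : (2 : ℤ) ≤ |(i : ℤ) - j| := h1
        exact_mod_cast h2
      have hst : (|(i : ℝ) - j| / 2) * δ ≤ |s - t| := by
        have h1 : |((i : ℝ) - j) * δ| ≤ |s - t| + δ := by
          have h11 := hs.1
          have h12 := hs.2
          have h13 := ht.1
          have h14 := ht.2
          have h15 := le_abs_self (s - t)
          have h16 := neg_abs_le (s - t)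
          rw [abs_le]
          constructor <;> nlinarith
        rw [abs_mul, abs_of_pos hδ0] at h1
        nlinarith
      have hst0 : 0 < |s - t| := lt_of_lt_of_le (by positivity) hst
      have hst4 : |s - t| ≤ 4 * Real.pi := by
        have hb : ∀ i ∈ Finset.Ico 1 N, ∀ s ∈ I i, 0 < s ∧ s ≤ Real.pi := fun i hi s hs => by
          have h1 : ((i : ℝ) + 1) ≤ N := by exact_mod_cast (Finset.mem_Ico.1 hi).2
          refine ⟨lt_of_le_of_lt (by positivity) hs.1, hs.2.trans ?_⟩
          rw [← hNδ]; gcongr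
        have h1 := hb i hi s hs
        have h2 := hb j hj t ht
        rw [abs_le]
        constructor <;> linarith
      have hne : s - t ≠ 0 := abs_pos.1 hst0
      have h1 := norm_sum_exp_le_div L (u := t - s) (by rw [← neg_sub]; exact neg_ne_zero.2 hne)
        (by rwa [abs_sub_comm])
      have h2 := norm_sum_exp_le_div (2 * L) hne hst4
      rw [abs_sub_comm] at h1
      have hd : 4 * Real.pi / |s - t| ≤ 4 * L / |(i : ℝ) - j| := by
        rw [div_le_div_iff₀ hst0 (by linarith), hL0, ← hNδ]
        nlinarith
      have hsq : 4 ≤ ((i : ℝ) - j) ^ 2 := by rw [← sq_abs]; nlinarith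
      calc _ ≤ (4 * L / |(i : ℝ) - j|) * (4 * L / |(i : ℝ) - j|) := by
            gcongr
            · exact h1.trans hd
            · exact h2.trans hd
        _ = 16 * L ^ 2 / ((i : ℝ) - j) ^ 2 := by
            rw [div_mul_div_comm, ← sq |(i : ℝ) - j|, sq_abs]; ring
        _ ≤ _ := by
            rw [mul_one_div, div_le_div_iff₀ (by linarith) (by linarith)]
            nlinarith [sq_nonneg (L : ℝ)]
  have hupper : ∑ κ ∈ S, ‖G (ν κ)‖ ^ 2 ≤ 32 * L ^ 2 * (6 * ∑ j ∈ Finset.Ico 1 N, a j ^ 2) := by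
    set Gj : ℕ → ℕ × ℕ → ℂ := fun j κ => ∫ t in I j,
      Complex.exp (Complex.I * ((ν κ / 4 * t : ℝ) : ℂ)) * g t with hGj
    have h1 : ((∑ κ ∈ S, ‖G (ν κ)‖ ^ 2 : ℝ) : ℂ) =
        ∑ i ∈ Finset.Ico 1 N, ∑ j ∈ Finset.Ico 1 N, ∑ κ ∈ S, Gj i κ * conj (Gj j κ) := by
      push_cast
      simp_rw [← Complex.mul_conj', hGsum, map_sum, Finset.sum_mul_sum]
      rw [Finset.sum_comm]
      exact Finset.sum_congr rfl fun i _ => Finset.sum_comm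
    have h2 : ∑ κ ∈ S, ‖G (ν κ)‖ ^ 2 = ‖((∑ κ ∈ S, ‖G (ν κ)‖ ^ 2 : ℝ) : ℂ)‖ := by
      rw [Complex.norm_real, Real.norm_of_nonneg (Finset.sum_nonneg fun _ _ => sq_nonneg _)]
    rw [h2, h1]
    calc _ ≤ ∑ i ∈ Finset.Ico 1 N, ∑ j ∈ Finset.Ico 1 N,
          32 * (L : ℝ) ^ 2 * (1 / (1 + ((i : ℝ) - j) ^ 2)) * (a i * a j) := by
          refine (norm_sum_le _ _).trans (Finset.sum_le_sum fun i hi => ?_)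
          refine (norm_sum_le _ _).trans (Finset.sum_le_sum fun j hj => ?_)
          exact norm_sum_integral_mul_conj_le S (fun κ => hec (ν κ)) (fun κ => he1 (ν κ))
            measurableSet_Ioc measurableSet_Ioc (hgI i hi) (hgI j hj) (hker i hi j hj)
      _ = 32 * (L : ℝ) ^ 2 * ∑ i ∈ Finset.Ico 1 N, ∑ j ∈ Finset.Ico 1 N,
          a i * a j * (1 / (1 + ((i : ℝ) - j) ^ 2)) := by
          simp_rw [Finset.mul_sum]
          refine Finset.sum_congr rfl fun i _ => Finset.sum_congr rfl fun j _ => ?_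
          ring
      _ ≤ _ := by
          gcongr
          exact sum_mul_inv_one_add_sub_sq_le _ a
  -- Each frequency `m₀ + d` with `d < L` is attained by the `L` pairs `(b, b + d)`, which all
  -- satisfy `b + d < 2L`.
  have hlower : L * ∑ d ∈ Finset.range L, ‖G (m₀ + d)‖ ^ 2 ≤ ∑ κ ∈ S, ‖G (ν κ)‖ ^ 2 := by
    rw [hS, Finset.sum_product]
    calc (L : ℝ) * ∑ d ∈ Finset.range L, ‖G (m₀ + d)‖ ^ 2
        = ∑ b ∈ Finset.range L, ∑ d ∈ Finset.range L, ‖G (m₀ + d)‖ ^ 2 := by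
          rw [Finset.sum_const, Finset.card_range, nsmul_eq_mul]
      _ ≤ _ := by
          refine Finset.sum_le_sum fun b hb => ?_
          have hb' := Finset.mem_range.1 hb
          calc ∑ d ∈ Finset.range L, ‖G (m₀ + d)‖ ^ 2
              = ∑ c ∈ Finset.Ico b (b + L), ‖G (ν (b, c))‖ ^ 2 := by
                rw [Finset.sum_Ico_eq_sum_range, Nat.add_sub_cancel_left]
                refine Finset.sum_congr rfl fun d _ => ?_
                simp only [hν]
                push_cast
                congr 3
                ring
            _ ≤ _ := by
                refine Finset.sum_le_sum_of_subset_of_nonneg (fun c hc => ?_)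
                  fun _ _ _ => sq_nonneg _
                have := Finset.mem_Ico.1 hc
                exact Finset.mem_range.2 (by omega)
  have hL0 : (L : ℝ) = 2 * N := by rw [hL]; push_cast; ring
  have hfin := hlower.trans hupper
  have haeq : ∑ j ∈ Finset.Ico 1 N, (∫ t in (j * δ)..((j + 1) * δ), ‖g t‖) ^ 2 =
      ∑ j ∈ Finset.Ico 1 N, a j ^ 2 := Finset.sum_congr rfl fun j _ => by
    rw [intervalIntegral.integral_of_le (hjle j)]
  rw [haeq]
  have hA0 : 0 ≤ ∑ j ∈ Finset.Ico 1 N, a j ^ 2 := Finset.sum_nonneg fun _ _ => sq_nonneg _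
  have hLpos : (0 : ℝ) < L := by rw [hL0]; positivity
  have h6 : (L : ℝ) * ∑ d ∈ Finset.range L, ‖G (m₀ + d)‖ ^ 2 ≤
      L * (192 * L * ∑ j ∈ Finset.Ico 1 N, a j ^ 2) := by linarith
  have h7 := le_of_mul_le_mul_left h6 hLpos
  rw [hL0] at h7
  refine h7.trans ?_
  nlinarith [mul_nonneg hN0.le hA0]

/-! ### Bounds for the cosine kernel and the mean-square estimate. -/

theorem abs_cos_sub_cos_le (x y : ℝ) : |Real.cos x - Real.cos y| ≤ |x ^ 2 - y ^ 2| / 2 := by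
  rw [Real.cos_sub_cos, abs_mul, abs_mul, show x ^ 2 - y ^ 2 = (x + y) * (x - y) by ring, abs_mul]
  have h1 : |Real.sin ((x + y) / 2)| ≤ |(x + y) / 2| := Real.abs_sin_le_abs
  have h2 : |Real.sin ((x - y) / 2)| ≤ |(x - y) / 2| := Real.abs_sin_le_abs
  calc _ ≤ |(-2 : ℝ)| * |(x + y) / 2| * |(x - y) / 2| := by gcongr
    _ = _ := by rw [abs_div, abs_div, abs_neg, abs_two]; ring

theorem abs_cos_sub_cos_div_sq_le (a b t : ℝ) :
    |(Real.cos (a * t) - Real.cos (b * t)) / t ^ 2| ≤ |a ^ 2 - b ^ 2| / 2 := by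
  rcases eq_or_ne t 0 with rfl | ht
  · simp; positivity
  rw [abs_div, abs_of_nonneg (sq_nonneg t), div_le_iff₀ (by positivity)]
  refine (abs_cos_sub_cos_le _ _).trans (le_of_eq ?_)
  rw [show (a * t) ^ 2 - (b * t) ^ 2 = (a ^ 2 - b ^ 2) * t ^ 2 by ring, abs_mul,
    abs_of_nonneg (sq_nonneg t)]
  ring

theorem abs_cos_sub_cos_div_sq_le_decay (a b t : ℝ) :
    |(Real.cos (a * t) - Real.cos (b * t)) / t ^ 2| ≤
      (2 + |a ^ 2 - b ^ 2| / 2) * (1 + t ^ 2)⁻¹ := by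
  rw [← div_eq_mul_inv, le_div_iff₀ (by positivity), mul_add, mul_one, add_comm]
  refine add_le_add ?_ (abs_cos_sub_cos_div_sq_le a b t)
  rcases eq_or_ne t 0 with rfl | ht
  · simp
  rw [abs_div, abs_of_nonneg (sq_nonneg t), div_mul_cancel₀ _ (by positivity)]
  refine (abs_sub _ _).trans ?_
  linarith [Real.abs_cos_le_one (a * t), Real.abs_cos_le_one (b * t)]

theorem measurable_cos_sub_cos_div_sq (a b : ℝ) :
    Measurable fun t : ℝ => (Real.cos (a * t) - Real.cos (b * t)) / t ^ 2 := by
  fun_prop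

namespace IsControlled

variable {φ : ℝ → ℂ} {w : ℝ → ℝ} {C : ℝ}

/-- The cosine also contains negative frequencies; conjugation reduces them to the positive ones,
with `conj φ` in place of `φ`. -/
theorem conj_comp (h : IsControlled φ w C) : IsControlled (fun t => conj (φ t)) w C where
  aestronglyMeasurable := Complex.continuous_conj.comp_aestronglyMeasurable h.aestronglyMeasurable
  bounded := by
    obtain ⟨M, hM⟩ := h.bounded
    exact ⟨M, fun t => by rw [RCLike.norm_conj]; exact hM t⟩
  shift := fun γ D hγ hD => by
    simp_rw [← map_sub, RCLike.norm_conj]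
    exact h.shift γ D hγ hD
  blocks := fun δ hδ => by
    simp_rw [RCLike.norm_conj]
    exact h.blocks δ hδ

/-- Since `|1 - e^{it/4}| ≤ t/4`, the integrand is at most `|φ(t)|/(4t)`. On a block with `j ≥ 1`
one has `1/(4jδ) ≤ 1/(2(j+1)δ)`, so its integral is at most half of the normalised block mean of
`φ`, and the large sieve applies. -/
theorem sum_norm_sq_middle_le (h : IsControlled φ w C) {N : ℕ} (hN : 1 ≤ N) (m₀ : ℝ) :
    ∑ d ∈ Finset.range (2 * N), ‖∫ t in (Real.pi / N)..Real.pi,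
        Complex.exp (Complex.I * (((m₀ + d) / 4 * t : ℝ) : ℂ)) *
          ((1 - Complex.exp (Complex.I * ((t / 4 : ℝ) : ℂ))) / (t : ℂ) ^ 2 * φ t)‖ ^ 2 ≤
      100 * N * (C * w (Real.pi / N)) ^ 2 := by
  have hN0 : (0 : ℝ) < N := by exact_mod_cast hN
  have hπ := Real.pi_pos
  set δ := Real.pi / N with hδ
  have hδ0 : 0 < δ := by positivity
  set g : ℝ → ℂ := fun t =>
    (1 - Complex.exp (Complex.I * ((t / 4 : ℝ) : ℂ))) / (t : ℂ) ^ 2 * φ t with hg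
  obtain ⟨M, hM⟩ := h.bounded
  have hjle : ∀ j : ℕ, (j : ℝ) * δ ≤ (j + 1) * δ := fun j => by nlinarith
  have hgi : ∀ j ∈ Finset.Ico 1 N, IntervalIntegrable g volume (j * δ) ((j + 1) * δ) := by
    intro j hj
    have hj1 : (1 : ℝ) ≤ j := by exact_mod_cast (Finset.mem_Ico.1 hj).1
    refine (intervalIntegrable_of_bounded h.aestronglyMeasurable hM _ _).continuousOn_mul ?_
    refine ContinuousOn.div (by fun_prop) (by fun_prop) fun t ht => ?_
    rw [Set.uIcc_of_le (hjle j)] at ht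
    have : 0 < t := lt_of_lt_of_le (by positivity) ht.1
    exact pow_ne_zero _ (by exact_mod_cast this.ne')
  refine (sum_norm_sq_integral_exp_le hN hgi m₀).trans ?_
  have hgn : ∀ t : ℝ, 0 < t → ‖g t‖ ≤ ‖φ t‖ * (4 * t)⁻¹ := fun t ht => by
    have h1 : ‖1 - Complex.exp (Complex.I * ((t / 4 : ℝ) : ℂ))‖ ≤ t / 4 := by
      rw [norm_sub_rev]
      refine (Real.norm_exp_I_mul_ofReal_sub_one_le).trans ?_
      rw [Real.norm_of_nonneg (by positivity)]
    rw [hg, norm_mul, norm_div, norm_pow, Complex.norm_real, Real.norm_of_nonneg ht.le, mul_comm]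
    gcongr
    rw [div_le_iff₀ (by positivity)]
    refine h1.trans (le_of_eq ?_)
    field_simp
  have hblock : ∀ j ∈ Finset.Ico 1 N, (∫ t in (j * δ)..((j + 1) * δ), ‖g t‖) ^ 2 ≤
      1 / 4 * (1 / ((j + 1) * δ) * ∫ t in (j * δ)..((j + 1) * δ), ‖φ t‖) ^ 2 := by
    intro j hj
    have hj1 : (1 : ℝ) ≤ j := by exact_mod_cast (Finset.mem_Ico.1 hj).1
    have hφ0 : 0 ≤ ∫ t in (j * δ)..((j + 1) * δ), ‖φ t‖ :=
      intervalIntegral.integral_nonneg (hjle j) fun t _ => norm_nonneg _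
    have h1 : ∫ t in (j * δ)..((j + 1) * δ), ‖g t‖ ≤
        1 / 2 * (1 / ((j + 1) * δ) * ∫ t in (j * δ)..((j + 1) * δ), ‖φ t‖) := by
      calc _ ≤ ∫ t in (j * δ)..((j + 1) * δ), ‖φ t‖ * (4 * (j * δ))⁻¹ := by
            refine intervalIntegral.integral_mono_on (hjle j) (hgi j hj).norm
              ((h.intervalIntegrable_norm _ _).mul_const _) fun t ht => ?_
            have ht0 : 0 < t := lt_of_lt_of_le (by positivity) ht.1
            refine (hgn t ht0).trans ?_
            have := ht.1
            gcongr
        _ = (4 * (j * δ))⁻¹ * ∫ t in (j * δ)..((j + 1) * δ), ‖φ t‖ := by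
            rw [intervalIntegral.integral_mul_const, mul_comm]
        _ ≤ (1 / 2 * (1 / ((j + 1) * δ))) * ∫ t in (j * δ)..((j + 1) * δ), ‖φ t‖ := by
            gcongr
            rw [div_mul_div_comm, one_mul, inv_eq_one_div,
              div_le_div_iff₀ (by positivity) (by positivity)]
            nlinarith
        _ = _ := by ring
    have h0 : 0 ≤ ∫ t in (j * δ)..((j + 1) * δ), ‖g t‖ :=
      intervalIntegral.integral_nonneg (hjle j) fun t _ => norm_nonneg _
    calc _ ≤ (1 / 2 * (1 / ((j + 1) * δ) * ∫ t in (j * δ)..((j + 1) * δ), ‖φ t‖)) ^ 2 := by gcongr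
      _ = _ := by ring
  have hsub : Finset.Ico 1 N ⊆ Finset.range (⌊Real.pi / δ⌋₊ + 1) := fun j hj => by
    rw [Finset.mem_range, Nat.lt_succ_iff]
    refine Nat.le_floor ?_
    have : Real.pi / δ = N := by rw [hδ]; field_simp
    rw [this]
    exact_mod_cast (Finset.mem_Ico.1 hj).2.le
  calc _ ≤ 400 * N * (1 / 4 * (C * w δ) ^ 2) := by
        gcongr
        refine (Finset.sum_le_sum hblock).trans ?_
        rw [← Finset.mul_sum]
        gcongr
        exact (Finset.sum_le_sum_of_subset_of_nonneg hsub fun _ _ _ => sq_nonneg _).trans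
          (h.blocks δ hδ0)
    _ = _ := by ring

/-- The kernel is bounded by half the difference of the squared frequencies, that is `(2m+1)/32 ≤
N/4`. -/
theorem norm_integral_near_zero_le (h : IsControlled φ w C) (hw : IsModulusType w) (hC : 0 ≤ C)
    {N m : ℕ} (hN : 1 ≤ N) (hm : 2 * m + 1 ≤ 8 * N) :
    ‖∫ t in (0 : ℝ)..(Real.pi / N),
      ((Real.cos (m / 4 * t) - Real.cos ((m + 1) / 4 * t)) / t ^ 2) • φ t‖ ≤
      C * w (Real.pi / N) := by
  have hN0 : (0 : ℝ) < N := by exact_mod_cast hN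
  have hπ := Real.pi_pos
  have hm' : 2 * (m : ℝ) + 1 ≤ 8 * N := by exact_mod_cast hm
  have hδ0 : 0 < Real.pi / N := by positivity
  have hwδ := hw.nonneg hδ0.le
  calc _ ≤ ∫ t in (0 : ℝ)..(Real.pi / N), N / 4 * ‖φ t‖ := by
        refine intervalIntegral.norm_integral_le_of_norm_le hδ0.le (ae_of_all _ fun t _ => ?_)
          ((h.intervalIntegrable_norm _ _).const_mul _)
        rw [norm_smul, Real.norm_eq_abs]
        gcongr
        refine (abs_cos_sub_cos_div_sq_le _ _ _).trans ?_
        rw [show ((m : ℝ) / 4) ^ 2 - ((m + 1) / 4) ^ 2 = -((2 * m + 1) / 16) by ring, abs_neg,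
          abs_of_nonneg (by positivity)]
        linarith
    _ ≤ N / 4 * (C * w (Real.pi / N) * (Real.pi / N)) := by
        rw [intervalIntegral.integral_const_mul]
        gcongr
        exact h.mean_le hw hC hδ0
    _ = Real.pi / 4 * (C * w (Real.pi / N)) := by field_simp
    _ ≤ 1 * (C * w (Real.pi / N)) := by
        gcongr
        linarith [Real.pi_le_four]
    _ = _ := one_mul _

/-- The half-line is cut at `π/N` and `π`. The outer two pieces are `O(w(π/N))` for each `m`
separately; the middle one is bounded only after summing over `m`. The range `m = 2n-1, ..., 4n`
consists of the candidates `2k-1, 2k` for `n ≤ k ≤ 2n`. -/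
theorem sum_norm_sq_integral_le (h : IsControlled φ w C) (hw : IsModulusType w) (hC : 0 ≤ C)
    {n : ℕ} (hn : 1 ≤ n) :
    ∑ d ∈ Finset.range (2 * (n + 1)), ‖∫ t in Set.Ioi (0 : ℝ),
      ((Real.cos ((2 * n - 1 + d : ℕ) / 4 * t) - Real.cos (((2 * n - 1 + d : ℕ) + 1) / 4 * t)) /
        t ^ 2) • φ t‖ ^ 2 ≤
      400000 * (n + 1) * (C * w (Real.pi / (n + 1))) ^ 2 := by
  have hπ := Real.pi_pos
  set N := n + 1 with hN
  have hNc : ((n : ℝ) + 1) = (N : ℝ) := by rw [hN]; push_cast; ring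
  rw [hNc]
  have hN1 : 1 ≤ N := by omega
  have hN0 : (0 : ℝ) < N := by exact_mod_cast hN1
  obtain ⟨M, hM⟩ := h.bounded
  set δ := Real.pi / N with hδ
  have hδ0 : 0 < δ := by positivity
  have hδπ : δ ≤ Real.pi := div_le_self hπ.le (by exact_mod_cast hN1)
  set W := C * w δ with hW
  have hW0 : 0 ≤ W := mul_nonneg hC (hw.nonneg hδ0.le)
  set G : (ℝ → ℂ) → ℕ → ℂ := fun ψ d => ∫ t in δ..Real.pi,
    Complex.exp (Complex.I * (((((2 * n - 1 : ℕ) : ℝ) + d) / 4 * t : ℝ) : ℂ)) *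
      ((1 - Complex.exp (Complex.I * ((t / 4 : ℝ) : ℂ))) / (t : ℂ) ^ 2 * ψ t) with hG
  have hG1 : ∑ d ∈ Finset.range (2 * N), ‖G φ d‖ ^ 2 ≤ 100 * N * W ^ 2 :=
    h.sum_norm_sq_middle_le hN1 _
  have hG2 : ∑ d ∈ Finset.range (2 * N), ‖G (fun t => conj (φ t)) d‖ ^ 2 ≤
      100 * N * W ^ 2 := h.conj_comp.sum_norm_sq_middle_le hN1 _
  have hterm : ∀ d ∈ Finset.range (2 * N), ‖∫ t in Set.Ioi (0 : ℝ),
      ((Real.cos ((2 * n - 1 + d : ℕ) / 4 * t) - Real.cos (((2 * n - 1 + d : ℕ) + 1) / 4 * t)) /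
        t ^ 2) • φ t‖ ^ 2 ≤
      3 * (W ^ 2 + (‖G φ d‖ ^ 2 + ‖G (fun t => conj (φ t)) d‖ ^ 2) / 2 +
        (224 * W) ^ 2) := by
    intro d hd
    have hd' := Finset.mem_range.1 hd
    have hm1 : 1 ≤ 2 * n - 1 + d := by omega
    have hm2 : N ≤ 2 * (2 * n - 1 + d) := by omega
    have hm3 : 2 * (2 * n - 1 + d) + 1 ≤ 8 * N := by omega
    have hmd : ((2 * n - 1 + d : ℕ) : ℝ) = ((2 * n - 1 : ℕ) : ℝ) + d := by push_cast; ring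
    set m := 2 * n - 1 + d with hm
    set F : ℝ → ℂ := fun t =>
      ((Real.cos (m / 4 * t) - Real.cos ((m + 1) / 4 * t)) / t ^ 2) • φ t with hF
    have hFi : Integrable F := integrable_smul_of_decay h.aestronglyMeasurable hM
      (measurable_cos_sub_cos_div_sq _ _) (abs_cos_sub_cos_div_sq_le_decay _ _)
    have hc : ∀ ν : ℝ, Integrable (fun t : ℝ => (Real.cos (ν * t) / t ^ 2) • φ t)
        (volume.restrict (Set.Ioi Real.pi)) := fun ν => by
      have hb : IntegrableOn (fun t : ℝ => 2 * (1 + t ^ 2)⁻¹ * M) (Set.Ioi Real.pi) :=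
        ((integrable_inv_one_add_sq.const_mul 2).mul_const M).integrableOn
      refine hb.mono' ((by fun_prop : Measurable fun t : ℝ =>
        Real.cos (ν * t) / t ^ 2).aestronglyMeasurable.smul h.aestronglyMeasurable.restrict) ?_
      filter_upwards [ae_restrict_mem measurableSet_Ioi] with t ht
      have ht3 : 1 ≤ t := by linarith [Real.pi_gt_three, Set.mem_Ioi.1 ht]
      rw [norm_smul]
      refine mul_le_mul ?_ (hM t) (norm_nonneg _) (by positivity)
      rw [norm_div, Real.norm_eq_abs, norm_pow, Real.norm_eq_abs, sq_abs, ← div_eq_mul_inv]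
      calc _ ≤ 1 / t ^ 2 := by gcongr; exact Real.abs_cos_le_one _
        _ ≤ _ := by
          rw [div_le_div_iff₀ (by positivity) (by positivity)]
          nlinarith
    have hp1 := h.norm_integral_near_zero_le hw hC hN1 hm3
    have hp3a := h.norm_integral_cos_le hw hC hN1 hm1 hm2
    have hp3b := h.norm_integral_cos_le hw hC hN1 (m := m + 1) (by omega) (by omega)
    have hp3 : ‖∫ t in Set.Ioi Real.pi, F t‖ ≤ 224 * W := by
      have : ∫ t in Set.Ioi Real.pi, F t =
          (∫ t in Set.Ioi Real.pi, (Real.cos (m / 4 * t) / t ^ 2) • φ t) -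
          ∫ t in Set.Ioi Real.pi, (Real.cos ((m + 1 : ℕ) / 4 * t) / t ^ 2) • φ t := by
        rw [← integral_sub (hc _) (hc _)]
        congr 1
        ext t
        rw [← sub_smul, ← sub_div]
        push_cast
        rfl
      rw [this]
      refine (norm_sub_le _ _).trans ?_
      linarith
    -- A difference of cosines is half the sum of `e^{imt/4}(1 - e^{it/4})` and its conjugate; in
    -- the second summand the conjugation is moved outside the integral.
    have hp2 : ∫ t in δ..Real.pi, F t =
        (G φ d + conj (G (fun t => conj (φ t)) d)) / 2 := by
      have hi : ∀ ψ : ℝ → ℂ, AEStronglyMeasurable ψ volume → (∀ t, ‖ψ t‖ ≤ M) →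
          IntervalIntegrable (fun t : ℝ =>
            Complex.exp (Complex.I * (((((2 * n - 1 : ℕ) : ℝ) + d) / 4 * t : ℝ) : ℂ)) *
            ((1 - Complex.exp (Complex.I * ((t / 4 : ℝ) : ℂ))) / (t : ℂ) ^ 2 * ψ t))
            volume δ Real.pi := fun ψ hψ hψM => by
        refine ((intervalIntegrable_of_bounded hψ hψM _ _).continuousOn_mul ?_).continuousOn_mul
          (by fun_prop)
        refine ContinuousOn.div (by fun_prop) (by fun_prop) fun t ht => ?_
        rw [Set.uIcc_of_le hδπ] at ht
        have : 0 < t := lt_of_lt_of_le hδ0 ht.1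
        exact pow_ne_zero _ (by exact_mod_cast this.ne')
      have hi1 := hi φ h.aestronglyMeasurable hM
      have hi2 := hi (fun t => conj (φ t)) h.conj_comp.aestronglyMeasurable
        (fun t => by rw [RCLike.norm_conj]; exact hM t)
      have hi2' := hi2
      rw [intervalIntegrable_iff] at hi2'
      have hi2c : IntervalIntegrable (fun t : ℝ => conj
          (Complex.exp (Complex.I * (((((2 * n - 1 : ℕ) : ℝ) + d) / 4 * t : ℝ) : ℂ)) *
            ((1 - Complex.exp (Complex.I * ((t / 4 : ℝ) : ℂ))) / (t : ℂ) ^ 2 *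
              conj (φ t)))) volume δ Real.pi :=
        intervalIntegrable_iff.2 ((LinearIsometryEquiv.integrable_comp_iff Complex.conjLIE).2 hi2')
      simp only [hG]
      rw [← intervalIntegral.intervalIntegral_conj, ← intervalIntegral.integral_add hi1 hi2c,
        ← intervalIntegral.integral_div]
      refine intervalIntegral.integral_congr fun t _ => ?_
      simp only [hF, Complex.real_smul, hmd, map_mul, map_div₀, map_sub, map_one, map_pow,
        Complex.conj_ofReal, ← Complex.exp_conj, Complex.conj_I, Complex.conj_conj]
      push_cast
      rw [Complex.cos, Complex.cos]
      set X : ℂ := ((2 * n - 1 : ℕ) : ℂ) with hX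
      have e1 : Complex.exp ((X + d + 1) / 4 * t * Complex.I) =
          Complex.exp (Complex.I * ((X + d) / 4 * t)) * Complex.exp (Complex.I * (t / 4)) := by
        rw [← Complex.exp_add]; congr 1; ring
      have e2 : Complex.exp (-((X + d + 1) / 4 * t) * Complex.I) =
          Complex.exp (-Complex.I * ((X + d) / 4 * t)) * Complex.exp (-Complex.I * (t / 4)) := by
        rw [← Complex.exp_add]; congr 1; ring
      have e3 : Complex.exp ((X + d) / 4 * t * Complex.I) =
          Complex.exp (Complex.I * ((X + d) / 4 * t)) := by congr 1; ring
      have e4 : Complex.exp (-((X + d) / 4 * t) * Complex.I) =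
          Complex.exp (-Complex.I * ((X + d) / 4 * t)) := by congr 1; ring
      rw [e1, e2, e3, e4]
      ring
    have hp2n : ‖∫ t in δ..Real.pi, F t‖ ^ 2 ≤
        (‖G φ d‖ ^ 2 + ‖G (fun t => conj (φ t)) d‖ ^ 2) / 2 := by
      have h1 : ‖∫ t in δ..Real.pi, F t‖ ≤
          (‖G φ d‖ + ‖G (fun t => conj (φ t)) d‖) / 2 := by
        rw [hp2, norm_div, Complex.norm_ofNat]
        gcongr
        refine (norm_add_le _ _).trans ?_
        rw [RCLike.norm_conj]
      have h2 := pow_le_pow_left₀ (norm_nonneg _) h1 2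
      nlinarith [sq_nonneg (‖G φ d‖ - ‖G (fun t => conj (φ t)) d‖)]
    have hsplit : ∫ t in Set.Ioi (0 : ℝ), F t =
        (∫ t in (0 : ℝ)..δ, F t) + (∫ t in δ..Real.pi, F t) + ∫ t in Set.Ioi Real.pi, F t := by
      rw [intervalIntegral.integral_add_adjacent_intervals hFi.intervalIntegrable
        hFi.intervalIntegrable,
        intervalIntegral.integral_interval_add_Ioi hFi.integrableOn hFi.integrableOn]
    rw [hsplit]
    have h1 := norm_add₃_le (a := ∫ t in (0 : ℝ)..δ, F t) (b := ∫ t in δ..Real.pi, F t)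
      (c := ∫ t in Set.Ioi Real.pi, F t)
    have h2 := pow_le_pow_left₀ (norm_nonneg _) h1 2
    have h3 := pow_le_pow_left₀ (norm_nonneg _) hp1 2
    have h4 := pow_le_pow_left₀ (norm_nonneg _) hp3 2
    set x := ‖∫ t in (0 : ℝ)..δ, F t‖
    set y := ‖∫ t in δ..Real.pi, F t‖
    set z := ‖∫ t in Set.Ioi Real.pi, F t‖
    have h5 : (x + y + z) ^ 2 ≤ 3 * (x ^ 2 + y ^ 2 + z ^ 2) := by
      nlinarith [sq_nonneg (x - y), sq_nonneg (y - z), sq_nonneg (x - z)]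
    linarith
  refine (Finset.sum_le_sum hterm).trans ?_
  rw [← Finset.mul_sum, Finset.sum_add_distrib, Finset.sum_add_distrib, ← Finset.sum_div,
    Finset.sum_add_distrib]
  simp only [Finset.sum_const, Finset.card_range, nsmul_eq_mul]
  push_cast
  nlinarith [mul_nonneg hN0.le (sq_nonneg W)]

end IsControlled

/-- The substitution `t = s/α` normalises the frequency gap to `1` and turns the block count
`[π/(αδ)]` into `[π/δ]`. The constant becomes `|C|` because `C` may be negative. -/
theorem isControlled_secondDiff {α C x : ℝ} (hα : 0 < α) {w : ℝ → ℝ} (hw : IsModulusType w)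
    {f : ℝ → ℂ} (hf : f ∈ omegaClassWith α 1 2 x w C) :
    IsControlled (fun s => secondDiff f x (α⁻¹ * s)) (fun s => w (α⁻¹ * s)) |C| where
  aestronglyMeasurable := by
    have hm := hf.1.1.1
    have h1 : AEStronglyMeasurable (fun t => f (x + t)) volume :=
      hm.comp_measurePreserving (measurePreserving_add_left volume x)
    have h2 : AEStronglyMeasurable (fun t => f (x - t)) volume :=
      hm.comp_measurePreserving (Measure.measurePreserving_sub_left volume x)
    have h3 : AEStronglyMeasurable (secondDiff f x) volume :=
      (h1.add h2).sub aestronglyMeasurable_const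
    exact h3.comp_quasiMeasurePreserving
      ⟨by fun_prop, by
        rw [Real.map_volume_mul_left (inv_ne_zero hα.ne')]
        exact Measure.smul_absolutelyContinuous⟩
  bounded := by
    obtain ⟨M, hM⟩ := hf.1.2.1
    refine ⟨M + M + 2 * M, fun t => ?_⟩
    refine (norm_sub_le _ _).trans (add_le_add ((norm_add_le _ _).trans
      (add_le_add (hM _) (hM _))) ?_)
    rw [norm_mul, Complex.norm_ofNat]
    gcongr
    exact hM x
  shift := fun γ D hγ hD => by
    have h1 := (hf.2.1 (α⁻¹ * γ) (α⁻¹ * D) (by positivity) (by positivity)).1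
    simp only [Real.rpow_one, div_one] at h1
    rw [one_div, inv_mul_le_iff₀ (by positivity)] at h1
    have h2 := intervalIntegral.integral_comp_mul_left (a := 0) (b := D)
      (fun t => ‖secondDiff f x t - secondDiff f x (t + α⁻¹ * γ)‖) (inv_ne_zero hα.ne')
    simp only [mul_zero, inv_inv, smul_eq_mul] at h2
    simp only [mul_add]
    rw [h2]
    have hwγ := hw.nonneg (a := α⁻¹ * γ) (by positivity)
    calc _ ≤ α * (α⁻¹ * D * (C * w (α⁻¹ * γ))) := by gcongr
      _ = C * w (α⁻¹ * γ) * D := by field_simp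
      _ ≤ _ := by gcongr; exact le_abs_self C
  blocks := fun δ hδ => by
    have h1 := hf.2.2 (α⁻¹ * δ) (by positivity)
    have hwδ := hw.nonneg (a := α⁻¹ * δ) (by positivity)
    simp only [gabisoniya, Real.rpow_one, div_one, Real.rpow_ofNat, ← Real.sqrt_eq_rpow,
      mul_inv_cancel_left₀ hα.ne'] at h1
    have h2 : C * w (α⁻¹ * δ) ≤ |C| * w (α⁻¹ * δ) := by gcongr; exact le_abs_self C
    have h3 := (Real.sqrt_le_left (by positivity)).1 (h1.trans h2)
    refine le_trans (le_of_eq (Finset.sum_congr rfl fun k _ => ?_)) h3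
    have h4 := intervalIntegral.integral_comp_mul_left (a := k * δ) (b := (k + 1) * δ)
      (fun t => ‖secondDiff f x t‖) (inv_ne_zero hα.ne')
    simp only [inv_inv, smul_eq_mul] at h4
    rw [h4, show α⁻¹ * (k * δ) = k * (α⁻¹ * δ) by ring,
      show α⁻¹ * ((k + 1) * δ) = (k + 1) * (α⁻¹ * δ) by ring]
    congr 1
    field_simp

/-! ### Mean values and Fourier coefficients. -/

/-- `F` has mean value `a` on the half line. -/
def HasMean (F : ℝ → ℂ) (a : ℂ) : Prop :=
  Tendsto (fun L : ℝ => (1 / (L : ℂ)) * ∫ t in (0 : ℝ)..L, F t) atTop (𝓝 a)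

theorem HasMean.bohrCoeff_eq {f : ℝ → ℂ} {l : ℝ} {a : ℂ}
    (h : HasMean (fun t => f t * Complex.exp (-(Complex.I * l * t))) a) : bohrCoeff f l = a :=
  h.limUnder_eq

theorem HasMean.const_mul {F : ℝ → ℂ} {a : ℂ} (h : HasMean F a) (c : ℂ) :
    HasMean (fun t => c * F t) (c * a) := by
  unfold HasMean at *
  simp_rw [intervalIntegral.integral_const_mul, mul_left_comm _ c]
  exact Tendsto.const_mul c h

theorem HasMean.add {F G : ℝ → ℂ} {a b : ℂ} (hF : HasMean F a) (hG : HasMean G b)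
    (hFi : ∀ L, IntervalIntegrable F volume 0 L) (hGi : ∀ L, IntervalIntegrable G volume 0 L) :
    HasMean (fun t => F t + G t) (a + b) := by
  unfold HasMean at *
  simp_rw [intervalIntegral.integral_add (hFi _) (hGi _), mul_add]
  exact Tendsto.add hF hG

theorem HasMean.sum {ι : Type*} {s : Finset ι} {F : ι → ℝ → ℂ} {a : ι → ℂ}
    (hF : ∀ i ∈ s, HasMean (F i) (a i))
    (hFi : ∀ i ∈ s, ∀ L, IntervalIntegrable (F i) volume 0 L) :
    HasMean (fun t => ∑ i ∈ s, F i t) (∑ i ∈ s, a i) := by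
  unfold HasMean at *
  have : ∀ L : ℝ, (1 / (L : ℂ)) * ∫ t in (0 : ℝ)..L, ∑ i ∈ s, F i t =
      ∑ i ∈ s, (1 / (L : ℂ)) * ∫ t in (0 : ℝ)..L, F i t := fun L => by
    rw [intervalIntegral.integral_finsetSum fun i hi => hFi i hi L, Finset.mul_sum]
  simp_rw [this]
  exact tendsto_finsetSum _ hF

theorem hasMean_one : HasMean (fun _ => 1) 1 := by
  refine tendsto_const_nhds.congr' ?_
  filter_upwards [eventually_gt_atTop 0] with L hL
  have : (L : ℂ) ≠ 0 := by exact_mod_cast hL.ne'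
  simp [this]

theorem tendsto_inv_mul_of_bounded {u : ℝ → ℂ} {M : ℝ} (hu : ∀ L, ‖u L‖ ≤ M) :
    Tendsto (fun L : ℝ => (1 / (L : ℂ)) * u L) atTop (𝓝 0) := by
  have h1 : Tendsto (fun L : ℝ => L⁻¹ * M) atTop (𝓝 0) := by
    simpa using tendsto_inv_atTop_zero.mul_const M
  refine squeeze_zero_norm' ?_ h1
  filter_upwards [eventually_gt_atTop 0] with L hL
  rw [norm_mul, norm_div, norm_one, Complex.norm_real, Real.norm_of_nonneg hL.le, one_div]
  gcongr
  exact hu L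

theorem hasMean_exp {μ : ℝ} (hμ : μ ≠ 0) :
    HasMean (fun t => Complex.exp (Complex.I * μ * t)) 0 := by
  have hc : Complex.I * (μ : ℂ) ≠ 0 := mul_ne_zero Complex.I_ne_zero (by exact_mod_cast hμ)
  refine tendsto_inv_mul_of_bounded (M := 2 / |μ|) fun L => ?_
  rw [integral_exp_mul_complex hc, norm_div, norm_mul, Complex.norm_I, one_mul, Complex.norm_real,
    Real.norm_eq_abs]
  gcongr
  refine (norm_sub_le _ _).trans ?_
  have : ∀ t : ℝ, ‖Complex.exp (Complex.I * μ * t)‖ = 1 := fun t => by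
    rw [mul_assoc, ← Complex.ofReal_mul, Complex.norm_exp_I_mul_ofReal]
  rw [this, this]
  norm_num

theorem continuous_trigPoly (s : Finset ℝ) (c : ℝ → ℂ) : Continuous (trigPoly s c) := by
  unfold trigPoly
  fun_prop

theorem norm_exp_I_mul_mul (l t : ℝ) : ‖Complex.exp (Complex.I * l * t)‖ = 1 := by
  rw [mul_assoc, ← Complex.ofReal_mul, Complex.norm_exp_I_mul_ofReal]

theorem norm_exp_neg_I_mul_mul (l t : ℝ) : ‖Complex.exp (-(Complex.I * l * t))‖ = 1 := by
  rw [Complex.exp_neg, norm_inv, norm_exp_I_mul_mul, inv_one]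

theorem norm_trigPoly_le (s : Finset ℝ) (c : ℝ → ℂ) (t : ℝ) :
    ‖trigPoly s c t‖ ≤ ∑ l ∈ s, ‖c l‖ := by
  refine (norm_sum_le _ _).trans (le_of_eq (Finset.sum_congr rfl fun l _ => ?_))
  rw [norm_mul, norm_exp_I_mul_mul, mul_one]

theorem hasMean_trigPoly (s : Finset ℝ) (c : ℝ → ℂ) (l : ℝ) :
    HasMean (fun t => trigPoly s c t * Complex.exp (-(Complex.I * l * t)))
      (if l ∈ s then c l else 0) := by
  have h1 : ∀ t : ℝ, trigPoly s c t * Complex.exp (-(Complex.I * l * t)) =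
      ∑ m ∈ s, c m * Complex.exp (Complex.I * (m - l : ℝ) * t) := fun t => by
    rw [trigPoly, Finset.sum_mul]
    refine Finset.sum_congr rfl fun m _ => ?_
    rw [mul_assoc, ← Complex.exp_add]
    congr 2
    push_cast
    ring
  simp_rw [h1]
  rw [← Finset.sum_ite_eq s l c]
  refine HasMean.sum (fun m _ => ?_)
    (fun m _ L => Continuous.intervalIntegrable (by fun_prop) _ _)
  split_ifs with h
  · subst h
    simpa using hasMean_one.const_mul (c l)
  · simpa using (hasMean_exp (sub_ne_zero.2 (Ne.symm h))).const_mul (c m)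

/-- The means of `F` eventually stay close to convergent means, hence form a Cauchy filter, and `ℂ`
is complete. -/
theorem HasMean.of_approx {F : ℝ → ℂ}
    (h : ∀ ε : ℝ, 0 < ε → ∃ (G : ℝ → ℂ) (a : ℂ), HasMean G a ∧ ∀ᶠ L : ℝ in atTop,
      ‖(1 / (L : ℂ)) * (∫ t in (0 : ℝ)..L, F t) - (1 / (L : ℂ)) * ∫ t in (0 : ℝ)..L, G t‖ ≤ ε) :
    ∃ a, HasMean F a := by
  refine cauchy_map_iff_exists_tendsto.1 (Metric.cauchy_iff.2 ⟨inferInstance, fun ε hε => ?_⟩)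
  obtain ⟨G, a, hG, hFG⟩ := h (ε / 5) (by positivity)
  have h2 := Metric.tendsto_nhds.1 hG (ε / 5) (by positivity)
  refine ⟨_, image_mem_map (hFG.and h2), ?_⟩
  rintro _ ⟨L, ⟨hL1, hL2⟩, rfl⟩ _ ⟨L', ⟨hL1', hL2'⟩, rfl⟩
  rw [← dist_eq_norm] at hL1 hL1'
  have h3 := (dist_triangle _ _ _).trans_lt (add_lt_add_of_le_of_lt hL1 hL2)
  have h3' := (dist_triangle _ _ _).trans_lt (add_lt_add_of_le_of_lt hL1' hL2')
  exact (dist_triangle_right _ _ a).trans_lt ((add_lt_add h3 h3').trans (by linarith))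

theorem HasMean.norm_sub_le {F G : ℝ → ℂ} {a b : ℂ} (hF : HasMean F a) (hG : HasMean G b) {ε : ℝ}
    (h : ∀ᶠ L : ℝ in atTop,
      ‖(1 / (L : ℂ)) * (∫ t in (0 : ℝ)..L, F t) - (1 / (L : ℂ)) * ∫ t in (0 : ℝ)..L, G t‖ ≤ ε) :
    ‖a - b‖ ≤ ε :=
  le_of_tendsto (Tendsto.sub hF hG).norm h

theorem setLIntegral_le_stepanovNorm (r : ℝ → ℂ) (u : ℝ) :
    ∫⁻ t in Set.Ioc u (u + Real.pi), ‖r t‖ₑ ≤ ENNReal.ofReal Real.pi * stepanovNorm 1 r := by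
  have h : ENNReal.ofReal (1 / Real.pi) * ∫⁻ t in Set.Ioc u (u + Real.pi), ‖r t‖ₑ ≤
      stepanovNorm 1 r := by
    have := le_iSup (fun u : ℝ => (ENNReal.ofReal (1 / Real.pi) *
      ∫⁻ t in Set.Ioc u (u + Real.pi), ‖r t‖ₑ ^ (1 : ℝ)) ^ (1 / (1 : ℝ))) u
    simp only [stepanovNorm, ENNReal.rpow_one, div_one] at this ⊢
    exact this
  calc _ = ENNReal.ofReal Real.pi * (ENNReal.ofReal (1 / Real.pi) *
        ∫⁻ t in Set.Ioc u (u + Real.pi), ‖r t‖ₑ) := by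
        rw [← mul_assoc, ← ENNReal.ofReal_mul Real.pi_pos.le, mul_one_div_cancel Real.pi_pos.ne',
          ENNReal.ofReal_one, one_mul]
    _ ≤ _ := by gcongr

theorem setLIntegral_natCast_mul_le (r : ℝ → ℂ) (m : ℕ) :
    ∫⁻ t in Set.Ioc 0 (m * Real.pi), ‖r t‖ₑ ≤
      ENNReal.ofReal (m * Real.pi) * stepanovNorm 1 r := by
  induction m with
  | zero => simp
  | succ m ih =>
    have h1 : Set.Ioc (0 : ℝ) ((m + 1 : ℕ) * Real.pi) ⊆
        Set.Ioc 0 (m * Real.pi) ∪ Set.Ioc (m * Real.pi) (m * Real.pi + Real.pi) := fun t ht => by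
      rcases le_or_gt t (m * Real.pi) with h | h
      · exact Or.inl ⟨ht.1, h⟩
      · exact Or.inr ⟨h, by have := ht.2; push_cast at this; linarith⟩
    refine (lintegral_mono_set h1).trans ((lintegral_union_le _ _ _).trans ?_)
    refine (add_le_add ih (setLIntegral_le_stepanovNorm r _)).trans (le_of_eq ?_)
    rw [← add_mul, ← ENNReal.ofReal_add (by positivity) Real.pi_pos.le]
    push_cast
    ring_nf

/-- The interval `[0, L]` is covered by `⌈L/π⌉` windows of length `π`, of total length at most `2L`
because `π ≤ L`; hence the factor `2`. -/
theorem norm_mean_le {r : ℝ → ℂ} {ε : ℝ} (hε : 0 ≤ ε)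
    (hr : stepanovNorm 1 r ≤ ENNReal.ofReal ε) {e : ℝ → ℂ} (he : ∀ t, ‖e t‖ ≤ 1) {L : ℝ}
    (hL : Real.pi ≤ L) : ‖(1 / (L : ℂ)) * ∫ t in (0 : ℝ)..L, r t * e t‖ ≤ 2 * ε := by
  have hπ := Real.pi_pos
  have hL0 : 0 < L := hπ.trans_le hL
  have h1 : ‖∫ t in (0 : ℝ)..L, r t * e t‖ₑ ≤ ENNReal.ofReal (2 * L * ε) := by
    rw [intervalIntegral.integral_of_le hL0.le]
    refine (enorm_integral_le_lintegral_enorm _).trans ?_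
    have hm1 : L ≤ ⌈L / Real.pi⌉₊ * Real.pi := (div_le_iff₀ hπ).1 (Nat.le_ceil _)
    have hm2 : ⌈L / Real.pi⌉₊ * Real.pi ≤ 2 * L := by
      have h3 := (Nat.ceil_lt_add_one (div_nonneg hL0.le hπ.le)).le
      have h4 : (⌈L / Real.pi⌉₊ : ℝ) * Real.pi ≤ (L / Real.pi + 1) * Real.pi := by gcongr
      rw [add_mul, div_mul_cancel₀ _ hπ.ne'] at h4
      linarith
    calc ∫⁻ t in Set.Ioc 0 L, ‖r t * e t‖ₑ ≤ ∫⁻ t in Set.Ioc 0 L, ‖r t‖ₑ := by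
          refine lintegral_mono fun t => ?_
          rw [enorm_mul]
          refine mul_le_of_le_one_right zero_le ?_
          rw [← ofReal_norm]
          exact ENNReal.ofReal_le_one.2 (he t)
      _ ≤ ∫⁻ t in Set.Ioc 0 (⌈L / Real.pi⌉₊ * Real.pi), ‖r t‖ₑ :=
          lintegral_mono_set (Set.Ioc_subset_Ioc_right hm1)
      _ ≤ ENNReal.ofReal (⌈L / Real.pi⌉₊ * Real.pi) * stepanovNorm 1 r :=
          setLIntegral_natCast_mul_le r _
      _ ≤ ENNReal.ofReal (2 * L) * ENNReal.ofReal ε := by gcongr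
      _ = _ := (ENNReal.ofReal_mul (by positivity)).symm
  rw [← ofReal_norm, ENNReal.ofReal_le_ofReal_iff (by positivity)] at h1
  rw [norm_mul, norm_div, norm_one, Complex.norm_real, Real.norm_of_nonneg hL0.le, one_div,
    inv_mul_le_iff₀ hL0]
  linarith

theorem exists_trigPoly_approx {f : ℝ → ℂ} (hf : f ∈ stepanovClass 1) {ε : ℝ} (hε : 0 < ε) :
    ∃ (s : Finset ℝ) (c : ℝ → ℂ),
      stepanovNorm 1 (fun t => f t - trigPoly s c t) ≤ ENNReal.ofReal ε := by
  obtain ⟨s, c, h⟩ := hf.2 (ENNReal.ofReal ε) (by simpa using hε)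
  exact ⟨s, c, h.le⟩

theorem eventually_norm_mean_sub_le {f g : ℝ → ℂ} (hf : ∀ L, IntervalIntegrable f volume 0 L)
    (hg : ∀ L, IntervalIntegrable g volume 0 L) {ε : ℝ} (hε : 0 ≤ ε)
    (h : stepanovNorm 1 (fun t => f t - g t) ≤ ENNReal.ofReal ε) (l : ℝ) :
    ∀ᶠ L : ℝ in atTop,
      ‖(1 / (L : ℂ)) * (∫ t in (0 : ℝ)..L, f t * Complex.exp (-(Complex.I * l * t))) -
        (1 / (L : ℂ)) * ∫ t in (0 : ℝ)..L, g t * Complex.exp (-(Complex.I * l * t))‖ ≤ 2 * ε := by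
  filter_upwards [eventually_ge_atTop Real.pi] with L hL
  have hc : ContinuousOn (fun t : ℝ => Complex.exp (-(Complex.I * l * t))) (Set.uIcc 0 L) := by
    fun_prop
  rw [← mul_sub, ← intervalIntegral.integral_sub ((hf L).mul_continuousOn hc)
    ((hg L).mul_continuousOn hc)]
  simp_rw [← sub_mul]
  exact norm_mean_le hε h (fun t => (norm_exp_neg_I_mul_mul l t).le) hL

/-- `bohrCoeff` is defined by `limUnder`, which is meaningful only once the limit is known to exist.
Existence comes from approximation by trigonometric polynomials. -/
theorem hasMean_bohrCoeff {f : ℝ → ℂ} (hf : f ∈ stepanovClass 1)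
    (hfi : ∀ L, IntervalIntegrable f volume 0 L) (l : ℝ) :
    HasMean (fun t => f t * Complex.exp (-(Complex.I * l * t))) (bohrCoeff f l) := by
  have : ∃ a, HasMean (fun t => f t * Complex.exp (-(Complex.I * l * t))) a := by
    refine HasMean.of_approx fun ε hε => ?_
    obtain ⟨s, c, h⟩ := exists_trigPoly_approx hf (half_pos hε)
    refine ⟨_, _, hasMean_trigPoly s c l, ?_⟩
    have := eventually_norm_mean_sub_le hfi
      (fun L => (continuous_trigPoly s c).intervalIntegrable _ _) (half_pos hε).le h l
    rwa [mul_div_cancel₀ _ two_ne_zero] at this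
  obtain ⟨a, ha⟩ := this
  rwa [ha.bohrCoeff_eq]

/-! ### The uniqueness theorem. -/

theorem norm_trigPoly_sub_le {s : Finset ℝ} {c : ℝ → ℂ} {a b η : ℝ}
    (h : ∀ l ∈ s, ‖Complex.exp (Complex.I * l * a) - Complex.exp (Complex.I * l * b)‖ ≤ η)
    (y : ℝ) : ‖trigPoly s c (a - b + y) - trigPoly s c y‖ ≤ η * ∑ l ∈ s, ‖c l‖ := by
  rw [trigPoly, trigPoly, ← Finset.sum_sub_distrib, Finset.mul_sum]
  refine (norm_sum_le _ _).trans (Finset.sum_le_sum fun l hl => ?_)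
  have e : c l * Complex.exp (Complex.I * l * (a - b + y : ℝ)) -
      c l * Complex.exp (Complex.I * l * y) =
      (Complex.exp (Complex.I * l * a) - Complex.exp (Complex.I * l * b)) *
        (c l * (Complex.exp (-(Complex.I * l * b)) * Complex.exp (Complex.I * l * y))) := by
    have e1 : Complex.exp (Complex.I * l * (a - b + y : ℝ)) = Complex.exp (Complex.I * l * a) *
        (Complex.exp (-(Complex.I * l * b)) * Complex.exp (Complex.I * l * y)) := by
      rw [← Complex.exp_add, ← Complex.exp_add]; congr 1; push_cast; ring
    have e2 : Complex.exp (Complex.I * l * b) * Complex.exp (-(Complex.I * l * b)) = 1 := by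
      rw [← Complex.exp_add, add_neg_cancel, Complex.exp_zero]
    rw [e1]
    linear_combination (c l * Complex.exp (Complex.I * l * y)) * e2
  rw [e, norm_mul, norm_mul, norm_mul, norm_exp_neg_I_mul_mul, norm_exp_I_mul_mul, mul_one, mul_one]
  gcongr
  exact h l hl

/-- The vectors `(e^{ila})_{l ∈ s}` form a bounded set in a finite-dimensional space, so finitely
many of them make an `η`-net. This net replaces relative density of almost periods in the uniqueness
theorem. -/
theorem exists_finite_exp_approx (s : Finset ℝ) {η : ℝ} (hη : 0 < η) :
    ∃ (ι : Type) (T : Finset ι) (τ : ι → ℝ), ∀ a : ℝ, ∃ i ∈ T, ∀ l ∈ s,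
      ‖Complex.exp (Complex.I * l * a) - Complex.exp (Complex.I * l * τ i)‖ ≤ η := by
  set F : ℝ → (s → ℂ) := fun a l => Complex.exp (Complex.I * (l : ℝ) * a) with hF
  have hb : Bornology.IsBounded (Set.range F) := by
    refine isBounded_iff_forall_norm_le.2 ⟨1, ?_⟩
    rintro _ ⟨a, rfl⟩
    refine (pi_norm_le_iff_of_nonneg zero_le_one).2 fun l => (norm_exp_I_mul_mul _ _).le
  have ht : TotallyBounded (Set.range F) :=
    hb.isCompact_closure.totallyBounded.subset subset_closure
  obtain ⟨t, hts, htf, htc⟩ := ht.exists_subset (Metric.dist_mem_uniformity hη)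
  refine ⟨s → ℂ, htf.toFinset, fun y => Function.invFun F y, fun a => ?_⟩
  obtain ⟨y, hy, hya⟩ := Set.mem_iUnion₂.1 (htc ⟨a, rfl⟩)
  refine ⟨y, htf.mem_toFinset.2 hy, fun l hl => ?_⟩
  have hinv : F (Function.invFun F y) = y := Function.invFun_eq (hts hy)
  have h1 : dist (F a ⟨l, hl⟩) (y ⟨l, hl⟩) ≤ η :=
    (dist_le_pi_dist _ _ _).trans (le_of_lt hya)
  rw [← hinv, dist_eq_norm] at h1
  exact h1

theorem continuous_of_trigPoly_approx {h : ℝ → ℂ}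
    (happ : ∀ ε : ℝ, 0 < ε → ∃ (s : Finset ℝ) (c : ℝ → ℂ), ∀ t, ‖h t - trigPoly s c t‖ ≤ ε) :
    Continuous h := by
  refine continuous_of_uniform_approx_of_continuous fun u hu => ?_
  obtain ⟨ε, hε, hεu⟩ := Metric.mem_uniformity_dist.1 hu
  obtain ⟨s, c, hsc⟩ := happ (ε / 2) (half_pos hε)
  refine ⟨trigPoly s c, continuous_trigPoly s c, fun y => hεu ?_⟩
  rw [dist_eq_norm]
  linarith [hsc y]

/-- Uniqueness: a uniform limit of trigonometric polynomials all of whose Fourier coefficients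
vanish is zero. -/
theorem eq_zero_of_hasMean_zero {h : ℝ → ℂ}
    (happ : ∀ ε : ℝ, 0 < ε → ∃ (s : Finset ℝ) (c : ℝ → ℂ), ∀ t, ‖h t - trigPoly s c t‖ ≤ ε)
    (hmean : ∀ l : ℝ, HasMean (fun t => h t * Complex.exp (-(Complex.I * l * t))) 0) (x : ℝ) :
    h x = 0 := by
  have hcont := continuous_of_trigPoly_approx happ
  obtain ⟨M, hM⟩ : ∃ M, ∀ t, ‖h t‖ ≤ M := by
    obtain ⟨s, c, hsc⟩ := happ 1 one_pos
    refine ⟨1 + ∑ l ∈ s, ‖c l‖, fun t => ?_⟩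
    have := norm_le_norm_sub_add (h t) (trigPoly s c t)
    linarith [hsc t, norm_trigPoly_le s c t]
  have hM0 : 0 ≤ M := (norm_nonneg _).trans (hM 0)
  -- The mean of `h · conj P` is a finite combination of Fourier coefficients of `h`, hence zero,
  -- and `h · conj (h - P)` is uniformly small.
  have hsq : HasMean (fun t => h t * conj (h t)) 0 := by
    refine Metric.tendsto_nhds.2 fun ε hε => ?_
    obtain ⟨s, c, hsc⟩ := happ (ε / (2 * (M + 1))) (by positivity)
    have hP : HasMean (fun t => ∑ l ∈ s, conj (c l) *
        (h t * Complex.exp (-(Complex.I * l * t)))) (∑ l ∈ s, conj (c l) * 0) :=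
      HasMean.sum (fun l _ => (hmean l).const_mul _)
        (fun l _ L => Continuous.intervalIntegrable (by fun_prop) _ _)
    have hP' : ∀ t : ℝ, ∑ l ∈ s, conj (c l) * (h t * Complex.exp (-(Complex.I * l * t))) =
        h t * conj (trigPoly s c t) := fun t => by
      rw [trigPoly, map_sum, Finset.mul_sum]
      refine Finset.sum_congr rfl fun l _ => ?_
      rw [map_mul, ← Complex.exp_conj, map_mul, map_mul, Complex.conj_I, Complex.conj_ofReal,
        Complex.conj_ofReal, neg_mul, neg_mul]
      ring
    simp_rw [hP'] at hP
    rw [← Finset.sum_mul, mul_zero] at hP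
    filter_upwards [Metric.tendsto_nhds.1 hP (ε / 2) (half_pos hε), eventually_gt_atTop 0]
      with L hL hL0
    rw [dist_zero_right] at hL ⊢
    have hPc := continuous_trigPoly s c
    have hsplit : ∫ t in (0 : ℝ)..L, h t * conj (h t) =
        (∫ t in (0 : ℝ)..L, h t * conj (trigPoly s c t)) +
          ∫ t in (0 : ℝ)..L, h t * conj (h t - trigPoly s c t) := by
      rw [← intervalIntegral.integral_add
        (Continuous.intervalIntegrable (by fun_prop) _ _)
        (Continuous.intervalIntegrable (by fun_prop) _ _)]
      refine intervalIntegral.integral_congr fun t _ => ?_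
      simp only [map_sub]
      ring
    have hrem : ‖∫ t in (0 : ℝ)..L, h t * conj (h t - trigPoly s c t)‖ ≤
        M * (ε / (2 * (M + 1))) * |L - 0| := by
      refine intervalIntegral.norm_integral_le_of_norm_le_const fun t _ => ?_
      rw [norm_mul, RCLike.norm_conj]
      gcongr
      · exact hM t
      · exact hsc t
    rw [hsplit, mul_add]
    refine lt_of_le_of_lt (norm_add_le _ _) ?_
    have h2 : ‖(1 / (L : ℂ)) * ∫ t in (0 : ℝ)..L, h t * conj (h t - trigPoly s c t)‖ ≤ ε / 2 := by
      rw [norm_mul, norm_div, norm_one, Complex.norm_real, Real.norm_of_nonneg hL0.le, one_div,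
        inv_mul_le_iff₀ hL0]
      refine hrem.trans ?_
      rw [sub_zero, abs_of_pos hL0, mul_comm]
      gcongr
      rw [mul_div_assoc', div_le_div_iff₀ (by positivity) two_pos]
      nlinarith
    linarith
  by_contra hx
  have hx0 : 0 < ‖h x‖ := norm_pos_iff.2 hx
  set ε := ‖h x‖ / 4 with hε
  have hε0 : 0 < ε := by positivity
  obtain ⟨s, c, hsc⟩ := happ ε hε0
  set S := ∑ l ∈ s, ‖c l‖ with hS
  have hS0 : 0 ≤ S := Finset.sum_nonneg fun _ _ => norm_nonneg _
  obtain ⟨ι, T, τ, hT⟩ := exists_finite_exp_approx s (η := ε / (S + 1)) (by positivity)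
  set u : ℝ → ℝ := fun t => ‖h t‖ ^ 2 with hu
  have huc : Continuous u := by fun_prop
  have huM : ∀ t, ‖u t‖ ≤ M ^ 2 := fun t => by
    rw [Real.norm_of_nonneg (sq_nonneg _)]
    exact pow_le_pow_left₀ (norm_nonneg _) (hM t) 2
  -- For each `a` some `τ_i` gives nearly the same exponentials, so `h(a + x - τ_i)` differs from
  -- `h(x)` by at most `3ε`, while `|h(x)| = 4ε`. Averaging over `a`, finitely many translates of
  -- `|h|²` would have total mean at least `ε²`, contradicting mean zero.
  have hlow : ∀ a : ℝ, ε ^ 2 ≤ ∑ i ∈ T, u (a + (x - τ i)) := fun a => by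
    obtain ⟨i, hi, hia⟩ := hT a
    refine le_trans ?_ (Finset.single_le_sum (f := fun i => u (a + (x - τ i)))
      (fun _ _ => sq_nonneg _) hi)
    have h1 := norm_trigPoly_sub_le (c := c) hia x
    have h2 : ε / (S + 1) * S ≤ ε := by
      rw [div_mul_eq_mul_div, div_le_iff₀ (by positivity)]; nlinarith
    rw [show a - τ i + x = a + (x - τ i) by ring] at h1
    refine pow_le_pow_left₀ hε0.le ?_ 2
    have h3 := hsc x
    have h4 := hsc (a + (x - τ i))
    have h5 : ‖h x‖ ≤ ‖h x - trigPoly s c x‖ +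
        ‖trigPoly s c (a + (x - τ i)) - trigPoly s c x‖ +
        ‖h (a + (x - τ i)) - trigPoly s c (a + (x - τ i))‖ + ‖h (a + (x - τ i))‖ := by
      have e : h x = (h x - trigPoly s c x) -
        (trigPoly s c (a + (x - τ i)) - trigPoly s c x) -
        (h (a + (x - τ i)) - trigPoly s c (a + (x - τ i))) + h (a + (x - τ i)) := by ring
      calc ‖h x‖ = _ := congrArg norm e
        _ ≤ _ := (norm_add_le _ _).trans (add_le_add ((norm_sub_le _ _).trans
          (add_le_add (norm_sub_le _ _) le_rfl)) le_rfl)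
    have h6 : ‖h x‖ = 4 * ε := by rw [hε]; ring
    linarith
  have hshift : ∀ (d L : ℝ), ∫ a in (0 : ℝ)..L, u (a + d) ≤
      (∫ a in (0 : ℝ)..L, u a) + 2 * (M ^ 2 * |d|) := fun d L => by
    have hi : ∀ a b, IntervalIntegrable u volume a b := fun a b => huc.intervalIntegrable a b
    rw [intervalIntegral.integral_comp_add_right, zero_add]
    have h1 := intervalIntegral.integral_add_adjacent_intervals (hi 0 d) (hi d (L + d))
    have h2 := intervalIntegral.integral_add_adjacent_intervals (hi 0 L) (hi L (L + d))
    have h3 := intervalIntegral.norm_integral_le_of_norm_le_const (a := 0) (b := d)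
      fun t _ => huM t
    have h4 := intervalIntegral.norm_integral_le_of_norm_le_const (a := L) (b := L + d)
      fun t _ => huM t
    rw [sub_zero, Real.norm_eq_abs] at h3
    rw [add_sub_cancel_left, Real.norm_eq_abs] at h4
    have h5 := neg_abs_le (∫ t in (0 : ℝ)..d, u t)
    have h6 := le_abs_self (∫ t in L..(L + d), u t)
    linarith
  have hlimu : Tendsto (fun L : ℝ => L⁻¹ * ∫ a in (0 : ℝ)..L, u a) atTop (𝓝 0) := by
    have h1 := (Complex.continuous_re.tendsto _).comp hsq
    rw [Complex.zero_re] at h1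
    refine h1.congr fun L => ?_
    have h2 : ∫ t in (0 : ℝ)..L, h t * conj (h t) = ((∫ t in (0 : ℝ)..L, u t : ℝ) : ℂ) := by
      rw [← intervalIntegral.integral_ofReal]
      refine intervalIntegral.integral_congr fun t _ => ?_
      simp only [hu, Complex.mul_conj', Complex.ofReal_pow]
    simp only [Function.comp_apply]
    rw [h2, one_div, ← Complex.ofReal_inv, ← Complex.ofReal_mul, Complex.ofReal_re]
  have hlim : Tendsto (fun L : ℝ => (T.card : ℝ) * (L⁻¹ * ∫ a in (0 : ℝ)..L, u a) +
      L⁻¹ * ∑ i ∈ T, 2 * (M ^ 2 * |x - τ i|)) atTop (𝓝 0) := by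
    have := (hlimu.const_mul (T.card : ℝ)).add
      (tendsto_inv_atTop_zero.mul_const (∑ i ∈ T, 2 * (M ^ 2 * |x - τ i|)))
    simpa using this
  have hge : ε ^ 2 ≤ 0 := by
    refine ge_of_tendsto hlim ?_
    filter_upwards [eventually_gt_atTop 0] with L hL
    have h1 : ∫ a in (0 : ℝ)..L, ε ^ 2 ≤ ∫ a in (0 : ℝ)..L, ∑ i ∈ T, u (a + (x - τ i)) :=
      intervalIntegral.integral_mono_on hL.le (by simp)
        (Continuous.intervalIntegrable (by fun_prop) _ _) fun a _ => hlow a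
    rw [intervalIntegral.integral_const, sub_zero, smul_eq_mul,
      intervalIntegral.integral_finsetSum fun i _ =>
        Continuous.intervalIntegrable (by fun_prop) _ _] at h1
    have h2 := h1.trans (Finset.sum_le_sum fun i _ => hshift (x - τ i) L)
    rw [Finset.sum_add_distrib, Finset.sum_const, nsmul_eq_mul] at h2
    rw [mul_left_comm, ← mul_add, inv_mul_eq_div, le_div_iff₀ hL]
    linarith
  exact absurd hge (not_le.2 (by positivity))

/-! ### Convolution with a decaying kernel. -/

theorem summable_inv_one_add_int_sq : Summable fun j : ℤ => (1 + (j : ℝ) ^ 2)⁻¹ := by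
  refine Summable.of_norm_bounded_eventually (Real.summable_one_div_int_pow (p := 2).2
    (by norm_num)) ?_
  filter_upwards [(Set.finite_singleton (0 : ℤ)).compl_mem_cofinite] with j hj
  have hj0 : (j : ℝ) ≠ 0 := by exact_mod_cast hj
  have : 0 < (j : ℝ) ^ 2 := by positivity
  rw [Real.norm_of_nonneg (by positivity), ← one_div]
  gcongr
  linarith

/-- On the window `(jπ, (j+1)π]` the kernel is at most `3B/(1+j²)`, and the Stepanov norm controls
`r` on every translated window. The bound is uniform in `x`, so Stepanov approximation becomes
uniform approximation after convolution. -/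
theorem norm_integral_smul_comp_add_le {k : ℝ → ℝ} {B : ℝ}
    (hB : ∀ t, |k t| ≤ B * (1 + t ^ 2)⁻¹) :
    ∃ K : ℝ, 0 ≤ K ∧ ∀ (r : ℝ → ℂ) (ε : ℝ), 0 ≤ ε → stepanovNorm 1 r ≤ ENNReal.ofReal ε →
      ∀ x, ‖∫ t, k t • r (x + t)‖ ≤ K * ε := by
  have hB0 : 0 ≤ B := by
    have := (abs_nonneg _).trans (hB 0)
    simpa using this
  have hπ := Real.pi_pos
  set b : ℤ → ℝ := fun j => 3 * B * Real.pi * (1 + (j : ℝ) ^ 2)⁻¹ with hb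
  have hb0 : ∀ j, 0 ≤ b j := fun j => by positivity
  have hbs : Summable b := summable_inv_one_add_int_sq.mul_left _
  refine ⟨∑' j, b j, tsum_nonneg hb0, fun r ε hε hr x => ?_⟩
  have hkb : ∀ j : ℤ, ∀ t ∈ Set.Ioc (j • Real.pi) ((j + 1) • Real.pi),
      |k t| ≤ 3 * B * (1 + (j : ℝ) ^ 2)⁻¹ := fun j t ht => by
    rw [zsmul_eq_mul, zsmul_eq_mul] at ht
    have h1 := ht.1
    have h2 := ht.2
    push_cast at h2
    refine (hB t).trans ?_
    have h3 : (1 + t ^ 2)⁻¹ ≤ 3 * (1 + (j : ℝ) ^ 2)⁻¹ := by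
      rw [← div_eq_mul_inv, inv_eq_one_div, div_le_div_iff₀ (by positivity) (by positivity)]
      have hπ3 := Real.pi_gt_three
      have h4 : (j * Real.pi) ^ 2 ≤ 2 * t ^ 2 + 2 * Real.pi ^ 2 := by
        have h5 : (t - j * Real.pi) ^ 2 ≤ Real.pi ^ 2 := by
          apply pow_le_pow_left₀ <;> nlinarith
        nlinarith [sq_nonneg (2 * t - j * Real.pi)]
      have h6 : (j : ℝ) ^ 2 * Real.pi ^ 2 ≤ (2 * t ^ 2 + 2) * Real.pi ^ 2 := by
        nlinarith [mul_nonneg (sq_nonneg t) (by nlinarith : (0 : ℝ) ≤ Real.pi ^ 2 - 1)]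
      have h7 := le_of_mul_le_mul_right h6 (by positivity)
      nlinarith
    calc B * (1 + t ^ 2)⁻¹ ≤ B * (3 * (1 + (j : ℝ) ^ 2)⁻¹) := by gcongr
      _ = _ := by ring
  have hpiece : ∀ j : ℤ, ∫⁻ t in Set.Ioc (j • Real.pi) ((j + 1) • Real.pi),
      ‖k t • r (x + t)‖ₑ ≤ ENNReal.ofReal (b j) * ENNReal.ofReal ε := fun j => by
    have h1 : ∫⁻ t in Set.Ioc (j • Real.pi) ((j + 1) • Real.pi), ‖k t • r (x + t)‖ₑ ≤
        ∫⁻ t in Set.Ioc (j • Real.pi) ((j + 1) • Real.pi),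
          ENNReal.ofReal (3 * B * (1 + (j : ℝ) ^ 2)⁻¹) * ‖r (x + t)‖ₑ := by
      refine setLIntegral_mono_ae' measurableSet_Ioc (ae_of_all _ fun t ht => ?_)
      rw [enorm_smul]
      gcongr
      rw [← ofReal_norm, Real.norm_eq_abs]
      exact ENNReal.ofReal_le_ofReal (hkb j t ht)
    refine h1.trans ?_
    rw [lintegral_const_mul' _ _ ENNReal.ofReal_ne_top]
    have h2 := (measurePreserving_add_left volume x).setLIntegral_comp_preimage_emb
      (measurableEmbedding_addLeft x) (fun t => ‖r t‖ₑ)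
      (Set.Ioc (x + j • Real.pi) (x + j • Real.pi + Real.pi))
    have h3 : (fun t => x + t) ⁻¹' Set.Ioc (x + j • Real.pi) (x + j • Real.pi + Real.pi) =
        Set.Ioc (j • Real.pi) ((j + 1) • Real.pi) := by
      ext t
      simp only [Set.mem_preimage, Set.mem_Ioc, add_smul, one_smul, add_assoc, add_lt_add_iff_left,
        add_le_add_iff_left]
    rw [h3] at h2
    rw [h2]
    calc _ ≤ ENNReal.ofReal (3 * B * (1 + (j : ℝ) ^ 2)⁻¹) *
          (ENNReal.ofReal Real.pi * ENNReal.ofReal ε) := by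
          gcongr
          exact (setLIntegral_le_stepanovNorm r _).trans (by gcongr)
      _ = _ := by
          rw [← mul_assoc, ← ENNReal.ofReal_mul (by positivity)]
          congr 2
          rw [hb]; ring
  have hfin : ‖∫ t, k t • r (x + t)‖ₑ ≤ ENNReal.ofReal ((∑' j, b j) * ε) := by
    refine (enorm_integral_le_lintegral_enorm _).trans ?_
    rw [← setLIntegral_univ, ← iUnion_Ioc_zsmul hπ,
      lintegral_iUnion (fun _ => measurableSet_Ioc) (Set.pairwise_disjoint_Ioc_zsmul Real.pi)]
    refine (ENNReal.tsum_le_tsum hpiece).trans (le_of_eq ?_)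
    rw [ENNReal.tsum_mul_right, ← ENNReal.ofReal_tsum_of_nonneg hb0 hbs,
      ENNReal.ofReal_mul (tsum_nonneg hb0)]
  rw [← ofReal_norm] at hfin
  exact (ENNReal.ofReal_le_ofReal_iff (mul_nonneg (tsum_nonneg hb0) hε)).1 hfin

section Convolution

variable {k : ℝ → ℝ} {B : ℝ} {f : ℝ → ℂ}

theorem integral_smul_trigPoly_comp_add (hk : Measurable k)
    (hB : ∀ t, |k t| ≤ B * (1 + t ^ 2)⁻¹) (s : Finset ℝ) (c : ℝ → ℂ) (x : ℝ) :
    ∫ t, k t • trigPoly s c (x + t) =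
      trigPoly s (fun l => c l * ∫ t : ℝ, k t • Complex.exp (Complex.I * l * t)) x := by
  have hint : ∀ l : ℝ, Integrable fun t : ℝ => k t • Complex.exp (Complex.I * l * t) := fun l =>
    integrable_smul_of_decay (Continuous.aestronglyMeasurable (by fun_prop))
      (fun t => (norm_exp_I_mul_mul l t).le) hk hB
  have h1 : ∀ t : ℝ, k t • trigPoly s c (x + t) = ∑ l ∈ s,
      (c l * Complex.exp (Complex.I * l * x)) * (k t • Complex.exp (Complex.I * l * t)) :=
    fun t => by
      rw [trigPoly, Finset.smul_sum]
      refine Finset.sum_congr rfl fun l _ => ?_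
      rw [Complex.ofReal_add, mul_add, Complex.exp_add, Complex.real_smul, Complex.real_smul]
      ring
  simp_rw [h1]
  rw [integral_finsetSum _ fun l _ => (hint l).const_mul _, trigPoly]
  refine Finset.sum_congr rfl fun l _ => ?_
  rw [integral_const_mul]
  ring

theorem exists_norm_convolution_sub_trigPoly_le (hk : Measurable k)
    (hB : ∀ t, |k t| ≤ B * (1 + t ^ 2)⁻¹) (hfm : AEStronglyMeasurable f volume) {M : ℝ}
    (hM : ∀ t, ‖f t‖ ≤ M) :
    ∃ K : ℝ, 0 ≤ K ∧ ∀ (s : Finset ℝ) (c : ℝ → ℂ) (ε : ℝ), 0 ≤ ε →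
      stepanovNorm 1 (fun t => f t - trigPoly s c t) ≤ ENNReal.ofReal ε → ∀ x : ℝ,
      ‖(∫ t, k t • f (x + t)) -
        trigPoly s (fun l => c l * ∫ t : ℝ, k t • Complex.exp (Complex.I * l * t)) x‖ ≤ K * ε := by
  obtain ⟨K, hK0, hK⟩ := norm_integral_smul_comp_add_le hB
  refine ⟨K, hK0, fun s c ε hε h x => ?_⟩
  have h1 := hK _ ε hε h x
  have hfx : AEStronglyMeasurable (fun t => f (x + t)) volume :=
    hfm.comp_measurePreserving (measurePreserving_add_left volume x)
  have hPx : AEStronglyMeasurable (fun t => trigPoly s c (x + t)) volume :=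
    ((continuous_trigPoly s c).comp (continuous_const.add continuous_id)).aestronglyMeasurable
  simp_rw [smul_sub] at h1
  rwa [integral_sub (integrable_smul_of_decay hfx (fun t => hM _) hk hB)
    (integrable_smul_of_decay hPx (fun t => norm_trigPoly_le s c _) hk hB),
    integral_smul_trigPoly_comp_add hk hB] at h1

theorem convolution_trigPoly_approx (hk : Measurable k)
    (hB : ∀ t, |k t| ≤ B * (1 + t ^ 2)⁻¹) (hf : f ∈ stepanovClass 1) {M : ℝ}
    (hM : ∀ t, ‖f t‖ ≤ M) {ε : ℝ} (hε : 0 < ε) :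
    ∃ (s : Finset ℝ) (c : ℝ → ℂ), ∀ x : ℝ,
      ‖(∫ t, k t • f (x + t)) - trigPoly s c x‖ ≤ ε := by
  obtain ⟨K, hK0, hK⟩ := exists_norm_convolution_sub_trigPoly_le hk hB hf.1 hM
  obtain ⟨s, c, h⟩ := exists_trigPoly_approx hf (ε := ε / (K + 1)) (by positivity)
  refine ⟨s, _, fun x => (hK s c _ (by positivity) h x).trans ?_⟩
  rw [mul_div_assoc', div_le_iff₀ (by positivity)]
  nlinarith

/-- For trigonometric polynomials the formula is explicit. Replacing `f` by a polynomial at Stepanov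
distance `ε` moves both sides by `O(ε)`, so no interchange of integrals is needed. -/
theorem hasMean_convolution (hk : Measurable k)
    (hB : ∀ t, |k t| ≤ B * (1 + t ^ 2)⁻¹) (hf : f ∈ stepanovClass 1) {M : ℝ}
    (hM : ∀ t, ‖f t‖ ≤ M) (l : ℝ) :
    HasMean (fun x => (∫ t, k t • f (x + t)) * Complex.exp (-(Complex.I * l * x)))
      (bohrCoeff f l * ∫ t : ℝ, k t • Complex.exp (Complex.I * l * t)) := by
  obtain ⟨K, hK0, hK⟩ := exists_norm_convolution_sub_trigPoly_le hk hB hf.1 hM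
  have hVc : Continuous fun x => ∫ t, k t • f (x + t) :=
    continuous_of_trigPoly_approx fun ε hε => convolution_trigPoly_approx hk hB hf hM hε
  have hfi : ∀ L, IntervalIntegrable f volume 0 L := fun L =>
    intervalIntegrable_of_bounded hf.1 hM _ _
  set kl : ℂ := ∫ t : ℝ, k t • Complex.exp (Complex.I * l * t) with hkl
  have hev : ∀ (s : Finset ℝ) (c : ℝ → ℂ) (ε : ℝ), 0 ≤ ε →
      stepanovNorm 1 (fun t => f t - trigPoly s c t) ≤ ENNReal.ofReal ε → ∀ᶠ L : ℝ in atTop,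
      ‖(1 / (L : ℂ)) * (∫ x in (0 : ℝ)..L,
          (∫ t, k t • f (x + t)) * Complex.exp (-(Complex.I * l * x))) -
        (1 / (L : ℂ)) * ∫ x in (0 : ℝ)..L,
          trigPoly s (fun l => c l * ∫ t : ℝ, k t • Complex.exp (Complex.I * l * t)) x *
            Complex.exp (-(Complex.I * l * x))‖ ≤ K * ε := by
    intro s c ε hε h
    filter_upwards [eventually_gt_atTop 0] with L hL
    have hPc := continuous_trigPoly s
      (fun l => c l * ∫ t : ℝ, k t • Complex.exp (Complex.I * l * t))
    rw [← mul_sub, ← intervalIntegral.integral_sub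
      (Continuous.intervalIntegrable (by fun_prop) _ _)
      (Continuous.intervalIntegrable (by fun_prop) _ _), norm_mul, norm_div, norm_one,
      Complex.norm_real, Real.norm_of_nonneg hL.le, one_div, inv_mul_le_iff₀ hL]
    refine (intervalIntegral.norm_integral_le_of_norm_le_const (C := K * ε) fun x _ => ?_).trans ?_
    · rw [← sub_mul, norm_mul, norm_exp_neg_I_mul_mul, mul_one]
      exact hK s c ε hε h x
    · rw [sub_zero, abs_of_pos hL, mul_comm]
  obtain ⟨a, ha⟩ : ∃ a, HasMean
      (fun x => (∫ t, k t • f (x + t)) * Complex.exp (-(Complex.I * l * x))) a := by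
    refine HasMean.of_approx fun ε hε => ?_
    obtain ⟨s, c, h⟩ := exists_trigPoly_approx hf (ε := ε / (K + 1)) (by positivity)
    refine ⟨_, _, hasMean_trigPoly s _ l, (hev s c _ (by positivity) h).mono fun L hL =>
      hL.trans ?_⟩
    rw [mul_div_assoc', div_le_iff₀ (by positivity)]
    nlinarith
  have hA := hasMean_bohrCoeff hf hfi l
  have hdist : ∀ ε : ℝ, 0 < ε → ‖a - bohrCoeff f l * kl‖ ≤ (K + 2 * ‖kl‖) * ε := fun ε hε => by
    obtain ⟨s, c, h⟩ := exists_trigPoly_approx hf hε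
    have h1 := ha.norm_sub_le (hasMean_trigPoly s _ l) (hev s c ε hε.le h)
    have h2 := hA.norm_sub_le (hasMean_trigPoly s c l) (eventually_norm_mean_sub_le hfi
      (fun L => (continuous_trigPoly s c).intervalIntegrable _ _) hε.le h l)
    have e : a - bohrCoeff f l * kl = (a - if l ∈ s then c l * kl else 0) -
        (bohrCoeff f l - if l ∈ s then c l else 0) * kl := by
      split_ifs <;> ring
    rw [e]
    calc _ ≤ K * ε + 2 * ε * ‖kl‖ := by
          refine (_root_.norm_sub_le _ _).trans (add_le_add h1 ?_)
          rw [norm_mul]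
          gcongr
      _ = _ := by ring
  have hz : ‖a - bohrCoeff f l * kl‖ ≤ 0 := by
    refine ge_of_tendsto (x := 𝓝[>] (0 : ℝ)) (f := fun ε => (K + 2 * ‖kl‖) * ε) ?_ ?_
    · have : Tendsto (fun ε : ℝ => (K + 2 * ‖kl‖) * ε) (𝓝 0) (𝓝 ((K + 2 * ‖kl‖) * 0)) :=
        tendsto_id.const_mul _
      rw [mul_zero] at this
      exact this.mono_left nhdsWithin_le_nhds
    · filter_upwards [self_mem_nhdsWithin] with ε hε using hdist ε hε
  rwa [sub_eq_zero.1 (norm_le_zero_iff.1 hz)] at ha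

end Convolution

/-! ### The trapezoid kernel and its Fourier transform. -/

/-- The kernel `(cos at - cos bt) / t²`; up to a factor its Fourier transform is the trapezoid
which is `1` on `[-a, a]` and vanishes outside `[-b, b]`. -/
noncomputable def cosKernel (a b t : ℝ) : ℝ := (Real.cos (a * t) - Real.cos (b * t)) / t ^ 2

/-- The normalising constant `∫ (1 - cos t) / t²`. -/
noncomputable def cosKernelMass : ℝ := ∫ t, cosKernel 0 1 t

theorem measurable_cosKernel (a b : ℝ) : Measurable (cosKernel a b) :=
  measurable_cos_sub_cos_div_sq a b

theorem abs_cosKernel_le (a b t : ℝ) :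
    |cosKernel a b t| ≤ (2 + |a ^ 2 - b ^ 2| / 2) * (1 + t ^ 2)⁻¹ :=
  abs_cos_sub_cos_div_sq_le_decay a b t

theorem cosKernel_neg (a b t : ℝ) : cosKernel a b (-t) = cosKernel a b t := by
  simp [cosKernel]

theorem integrable_cosKernel (a b : ℝ) : Integrable (cosKernel a b) :=
  (integrable_inv_one_add_sq.const_mul _).mono' (measurable_cosKernel a b).aestronglyMeasurable
    (ae_of_all _ fun t => abs_cosKernel_le a b t)

theorem cosKernelMass_pos : 0 < cosKernelMass := by
  have h0 : ∀ t, 0 ≤ cosKernel 0 1 t := fun t => by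
    rw [cosKernel, zero_mul, Real.cos_zero, one_mul]
    exact div_nonneg (by linarith [Real.cos_le_one t]) (sq_nonneg t)
  rw [cosKernelMass, integral_pos_iff_support_of_nonneg h0 (integrable_cosKernel 0 1)]
  refine lt_of_lt_of_le ?_ (measure_mono (s := Set.Ioo (0 : ℝ) 1) fun t ht => ?_)
  · simp
  · have h1 : Real.cos t < Real.cos 0 :=
      Real.cos_lt_cos_of_nonneg_of_le_pi le_rfl (by linarith [ht.2, Real.pi_gt_three]) ht.1
    rw [Real.cos_zero] at h1
    have h2 : 0 < cosKernel 0 1 t := by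
      rw [cosKernel, zero_mul, Real.cos_zero, one_mul]
      exact div_pos (by linarith) (pow_pos ht.1 2)
    exact h2.ne'

/-- Scaling alone gives the dependence on `b`, so only the positivity of the mass is needed, not its
value. -/
theorem integral_cosKernel_zero (b : ℝ) : ∫ t, cosKernel 0 b t = |b| * cosKernelMass := by
  rcases eq_or_ne b 0 with rfl | hb
  · simp [cosKernel]
  have h1 : ∀ t, cosKernel 0 b t = b ^ 2 * cosKernel 0 1 (b * t) := fun t => by
    rcases eq_or_ne t 0 with rfl | ht
    · simp [cosKernel]
    · simp only [cosKernel, zero_mul, one_mul]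
      field_simp
  simp_rw [h1]
  rw [integral_const_mul, Measure.integral_comp_mul_left, smul_eq_mul, ← mul_assoc, abs_inv,
    ← sq_abs, sq, mul_assoc |b|, mul_inv_cancel₀ (abs_ne_zero.2 hb), mul_one]
  rfl

theorem integral_cosKernel (a b : ℝ) :
    ∫ t, cosKernel a b t = (|b| - |a|) * cosKernelMass := by
  have h1 : ∀ t, cosKernel a b t = cosKernel 0 b t - cosKernel 0 a t := fun t => by
    simp only [cosKernel]; ring
  simp_rw [h1]
  rw [integral_sub (integrable_cosKernel 0 b) (integrable_cosKernel 0 a),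
    integral_cosKernel_zero, integral_cosKernel_zero]
  ring

/-- By evenness the exponential becomes `cos lt`, and the product formula turns the kernel times `2
cos lt` into the sum of the kernels with parameters shifted by `l` and by `-l`, whose integrals are
known. -/
theorem integral_cosKernel_smul_exp (a b l : ℝ) :
    ∫ t : ℝ, cosKernel a b t • Complex.exp (Complex.I * l * t) =
      (((|b + l| + |b - l| - |a + l| - |a - l|) / 2 * cosKernelMass : ℝ) : ℂ) := by
  set g : ℝ → ℂ := fun t => cosKernel a b t • Complex.exp (Complex.I * l * t) with hg
  have hgi : Integrable g :=
    integrable_smul_of_decay (Continuous.aestronglyMeasurable (by fun_prop))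
      (fun t => (norm_exp_I_mul_mul l t).le) (measurable_cosKernel a b) (abs_cosKernel_le a b)
  have h1 : ∀ t, g t + g (-t) =
      ((cosKernel (a + l) (b + l) t + cosKernel (a - l) (b - l) t : ℝ) : ℂ) := fun t => by
    simp only [hg, cosKernel_neg, ← smul_add]
    have h2 : Complex.exp (Complex.I * l * t) + Complex.exp (Complex.I * l * (-t : ℝ)) =
        ((2 * Real.cos (l * t) : ℝ) : ℂ) := by
      push_cast
      rw [Complex.cos, mul_div_cancel₀ _ two_ne_zero]
      congr 2 <;> ring
    rw [h2, Complex.real_smul, ← Complex.ofReal_mul]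
    congr 1
    simp only [cosKernel, add_mul, sub_mul, Real.cos_add, Real.cos_sub]
    ring
  have h2 : (2 : ℂ) * ∫ t, g t = ∫ t, (g t + g (-t)) := by
    rw [integral_add hgi hgi.comp_neg, integral_neg_eq_self g volume]
    ring
  simp_rw [h1] at h2
  rw [integral_complex_ofReal, integral_add (integrable_cosKernel _ _) (integrable_cosKernel _ _),
    integral_cosKernel, integral_cosKernel] at h2
  have h3 : ∫ t, g t = (2 : ℂ) * (∫ t, g t) / 2 := by ring
  rw [h3, h2]
  push_cast
  ring

theorem integral_cosKernel_smul_exp_of_le {a b l : ℝ} (hab : a ≤ b) (hl : |l| ≤ a) :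
    ∫ t : ℝ, cosKernel a b t • Complex.exp (Complex.I * l * t) =
      (((b - a) * cosKernelMass : ℝ) : ℂ) := by
  rw [integral_cosKernel_smul_exp]
  obtain ⟨h1, h2⟩ := abs_le.1 hl
  rw [abs_of_nonneg (by linarith : 0 ≤ b + l), abs_of_nonneg (by linarith : 0 ≤ b - l),
    abs_of_nonneg (by linarith : 0 ≤ a + l), abs_of_nonneg (by linarith : 0 ≤ a - l)]
  congr 2
  ring

theorem integral_cosKernel_smul_exp_of_ge {a b l : ℝ} (ha : 0 ≤ a) (hab : a ≤ b) (hl : b ≤ |l|) :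
    ∫ t : ℝ, cosKernel a b t • Complex.exp (Complex.I * l * t) = 0 := by
  rw [integral_cosKernel_smul_exp]
  have : |b + l| + |b - l| - |a + l| - |a - l| = 0 := by
    rcases le_total 0 l with h | h
    · rw [abs_of_nonneg h] at hl
      rw [abs_of_nonneg (by linarith : 0 ≤ b + l), abs_of_nonpos (by linarith : b - l ≤ 0),
        abs_of_nonneg (by linarith : 0 ≤ a + l), abs_of_nonpos (by linarith : a - l ≤ 0)]
      ring
    · rw [abs_of_nonpos h] at hl
      rw [abs_of_nonpos (by linarith : b + l ≤ 0), abs_of_nonneg (by linarith : 0 ≤ b - l),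
        abs_of_nonpos (by linarith : a + l ≤ 0), abs_of_nonneg (by linarith : 0 ≤ a - l)]
      ring
  rw [this]
  simp

/-! ### Partial sums as convolutions. -/

theorem partialSum_eq_trigPoly {f : ℝ → ℂ} {γ : ℝ}
    (hfin : {l : ℝ | bohrCoeff f l ≠ 0 ∧ |l| ≤ γ}.Finite) (x : ℝ) :
    partialSum f γ x = trigPoly hfin.toFinset (bohrCoeff f) x := by
  refine finsum_mem_eq_sum_of_inter_support_eq (s := {l : ℝ | |l| ≤ γ})
    (fun l : ℝ => bohrCoeff f l * Complex.exp (Complex.I * l * x)) ?_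
  ext l
  simp only [Set.mem_inter_iff, Set.mem_ofPred_eq, Function.mem_support, Finset.mem_coe,
    Set.Finite.mem_toFinset, and_congr_left_iff]
  intro h
  exact ⟨fun h' => ⟨left_ne_zero_of_mul h, h'⟩, fun h' => h'.2⟩

/-- Both sides are uniform limits of trigonometric polynomials with the same Fourier coefficients:
the gap hypothesis excludes exponents on the slopes of the trapezoid, where the multiplier is
neither full nor zero. Uniqueness then gives equality at every point. -/
theorem integral_cosKernel_smul_eq_partialSum {f : ℝ → ℂ} (hf : f ∈ stepanovClass 1) {M : ℝ}
    (hM : ∀ t, ‖f t‖ ≤ M) {a b γ : ℝ} (ha : 0 ≤ a) (hab : a ≤ b)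
    (hgap : ∀ l, bohrCoeff f l ≠ 0 → |l| ≤ a ∨ b ≤ |l|)
    (hγ : ∀ l, bohrCoeff f l ≠ 0 → (|l| ≤ γ ↔ |l| ≤ a))
    (hfin : {l : ℝ | bohrCoeff f l ≠ 0 ∧ |l| ≤ γ}.Finite) (x : ℝ) :
    ∫ t, cosKernel a b t • f (x + t) =
      (((b - a) * cosKernelMass : ℝ) : ℂ) * partialSum f γ x := by
  set c₀ : ℂ := (((b - a) * cosKernelMass : ℝ) : ℂ) with hc₀
  have hkm := measurable_cosKernel a b
  have hkB := abs_cosKernel_le a b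
  rw [partialSum_eq_trigPoly hfin]
  set S := hfin.toFinset
  have hscal : ∀ y, c₀ * trigPoly S (bohrCoeff f) y =
      trigPoly S (fun l => c₀ * bohrCoeff f l) y := fun y => by
    simp only [trigPoly, Finset.mul_sum, mul_assoc]
  have hVc : Continuous fun x => ∫ t, cosKernel a b t • f (x + t) :=
    continuous_of_trigPoly_approx fun ε hε => convolution_trigPoly_approx hkm hkB hf hM hε
  rw [hscal, ← sub_eq_zero]
  refine eq_zero_of_hasMean_zero (h := fun x => (∫ t, cosKernel a b t • f (x + t)) -
    trigPoly S (fun l => c₀ * bohrCoeff f l) x) (fun ε hε => ?_) (fun l => ?_) x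
  · obtain ⟨s, c, h⟩ := convolution_trigPoly_approx hkm hkB hf hM hε
    classical
    refine ⟨s ∪ S, fun l => (if l ∈ s then c l else 0) -
      (if l ∈ S then c₀ * bohrCoeff f l else 0), fun y => ?_⟩
    have e : trigPoly (s ∪ S) (fun l => (if l ∈ s then c l else 0) -
        (if l ∈ S then c₀ * bohrCoeff f l else 0)) y =
        trigPoly s c y - trigPoly S (fun l => c₀ * bohrCoeff f l) y := by
      simp only [trigPoly, sub_mul, Finset.sum_sub_distrib, ite_mul, zero_mul,
        Finset.sum_ite_mem, Finset.union_inter_cancel_left, Finset.union_inter_cancel_right]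
    rw [e, sub_sub_sub_cancel_right]
    exact h y
  · have h1 := hasMean_convolution hkm hkB hf hM l
    have h2 := (hasMean_trigPoly S (fun l => c₀ * bohrCoeff f l) l).const_mul (-1)
    have hPc := continuous_trigPoly S (fun l => c₀ * bohrCoeff f l)
    have h3 := h1.add h2 (fun L => Continuous.intervalIntegrable (by fun_prop) _ _)
      (fun L => Continuous.intervalIntegrable (by fun_prop) _ _)
    have e : bohrCoeff f l * (∫ t : ℝ, cosKernel a b t • Complex.exp (Complex.I * l * t)) +
        -1 * (if l ∈ S then c₀ * bohrCoeff f l else 0) = 0 := by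
      by_cases hl : bohrCoeff f l = 0
      · simp [hl]
      rcases le_or_gt |l| a with hla | hla
      · have hS : l ∈ S := hfin.mem_toFinset.2 ⟨hl, (hγ l hl).2 hla⟩
        rw [if_pos hS, integral_cosKernel_smul_exp_of_le hab hla]
        ring
      · have hS : l ∉ S := fun h => absurd ((hγ l hl).1 (hfin.mem_toFinset.1 h).2) (not_le.2 hla)
        rw [if_neg hS, integral_cosKernel_smul_exp_of_ge ha hab
          ((hgap l hl).resolve_left (not_le.2 hla))]
        ring
    rw [e] at h3
    refine h3.congr fun L => ?_
    congr 2
    ext y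
    ring

theorem abs_mem_fourierExponents {f : ℝ → ℂ} {l : ℝ} (h : bohrCoeff f l ≠ 0) :
    |l| ∈ fourierExponents f := by
  refine ⟨abs_nonneg l, ?_⟩
  rcases abs_choice l with h' | h'
  · rw [h']; exact Or.inl h
  · rw [h', neg_neg]; exact Or.inr h

/-- Positive exponents at distance at least `α` have different values of `⌊l/α⌋`. Finiteness matters
because `partialSum` is a `finsum`, which is `0` on infinite support. -/
theorem finite_setOf_bohrCoeff_ne_zero {α : ℝ} (hα : 0 < α) {f : ℝ → ℂ}
    (hsep : ∀ l ∈ fourierExponents f, ∀ m ∈ fourierExponents f, 0 < l → l < m → α ≤ m - l)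
    (γ : ℝ) : {l : ℝ | bohrCoeff f l ≠ 0 ∧ |l| ≤ γ}.Finite := by
  set E : Set ℝ := {l | l ∈ fourierExponents f ∧ 0 < l ∧ l ≤ γ} with hE
  have hEfin : E.Finite := by
    refine Set.Finite.of_finite_image (f := fun l : ℝ => ⌊l / α⌋₊)
      ((Set.finite_Iic ⌊γ / α⌋₊).subset ?_) ?_
    · rintro _ ⟨l, hl, rfl⟩
      have := hl.2.2
      exact Nat.floor_le_floor (by gcongr)
    · have key : ∀ l ∈ E, ∀ m ∈ E, l < m → ⌊l / α⌋₊ ≠ ⌊m / α⌋₊ := fun l hl m hm hlm => by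
        have h1 := hsep l hl.1 m hm.1 hl.2.1 hlm
        have h2 : l / α + 1 ≤ m / α := by
          rw [div_add_one hα.ne']; gcongr; linarith
        have h3 := Nat.floor_le_floor h2
        rw [Nat.floor_add_one (div_nonneg hl.2.1.le hα.le)] at h3
        omega
      intro l hl m hm hlm
      rcases lt_trichotomy l m with h | h | h
      · exact absurd hlm (key l hl m hm h)
      · exact h
      · exact absurd hlm.symm (key m hm l hl h)
  refine ((Set.finite_singleton (0 : ℝ)).union (hEfin.union (hEfin.image Neg.neg))).subset ?_
  rintro l ⟨hl, hlγ⟩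
  have hmem := abs_mem_fourierExponents hl
  rcases lt_trichotomy l 0 with h | h | h
  · rw [abs_of_neg h] at hmem hlγ
    exact Or.inr (Or.inr ⟨-l, ⟨hmem, by linarith, hlγ⟩, neg_neg l⟩)
  · exact Or.inl h
  · rw [abs_of_pos h] at hmem hlγ
    exact Or.inr (Or.inl ⟨hmem, h, hlγ⟩)

/-! ### The case `n = 0`: approximation by constants. -/

/-- The factor `σ` rotates the right half-plane so that the imaginary axis lands on the real line,
where `g` is bounded by `M`. The factor `e^{-εz}` absorbs the growth along the positive axis,
Phragmén–Lindelöf gives the bound `M`, and then `ε → 0`. -/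
theorem norm_le_of_mem_entireExpType_zero {g : ℂ → ℂ} (hg : g ∈ entireExpType 0) {M : ℝ}
    (hM : ∀ t : ℝ, ‖g t‖ ≤ M) {σ : ℂ} (hσ : ‖σ‖ = 1) (hσI : ∃ r : ℝ, σ * Complex.I = r) {z : ℂ}
    (hz : 0 ≤ z.re) : ‖g (σ * z)‖ ≤ M := by
  obtain ⟨r, hr⟩ := hσI
  have hε : ∀ ε : ℝ, 0 < ε → ‖Complex.exp (-(ε * z)) * g (σ * z)‖ ≤ M := fun ε hε => by
    obtain ⟨C, hC⟩ := hg.2.1 ε hε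
    have hgd := hg.1
    have hexp : ∀ z : ℂ, ‖Complex.exp (-(ε * z))‖ = Real.exp (-(ε * z.re)) := fun z => by
      rw [Complex.norm_exp]; simp
    have hC' : ∀ z : ℂ, ‖g (σ * z)‖ ≤ C * Real.exp (ε * ‖z‖) := fun z => by
      have := hC (σ * z)
      rwa [zero_add, norm_mul, hσ, one_mul] at this
    have hC0 : 0 ≤ C := by
      have := (norm_nonneg _).trans (hC' 0)
      simpa using this
    refine PhragmenLindelof.right_half_plane_of_bounded_on_real
      (f := fun z => Complex.exp (-(ε * z)) * g (σ * z)) ?_ ⟨1, by norm_num, ε, ?_⟩ ?_ ?_ hz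
    · exact Differentiable.diffContOnCl (by fun_prop)
    · refine Asymptotics.IsBigO.of_bound C (eventually_inf_principal.2
        (Eventually.of_forall fun z hz => ?_))
      have hz' : 0 < z.re := hz
      rw [norm_mul, hexp, Real.rpow_one, Real.norm_eq_abs, Real.abs_exp]
      calc _ ≤ 1 * (C * Real.exp (ε * ‖z‖)) := by
            gcongr
            · rw [Real.exp_le_one_iff]
              have : 0 ≤ ε * z.re := by positivity
              linarith
            · exact hC' z
        _ = _ := one_mul _
    · refine isBoundedUnder_of_eventually_le (a := C) ?_
      filter_upwards [eventually_ge_atTop 0] with x hx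
      rw [norm_mul, hexp, Complex.ofReal_re]
      calc _ ≤ Real.exp (-(ε * x)) * (C * Real.exp (ε * x)) := by
            gcongr
            have := hC' x
            rwa [Complex.norm_real, Real.norm_of_nonneg hx] at this
        _ = C * (Real.exp (-(ε * x)) * Real.exp (ε * x)) := by ring
        _ = C := by rw [← Real.exp_add, neg_add_cancel, Real.exp_zero, mul_one]
    · intro y
      rw [norm_mul, hexp]
      have e : σ * (y * Complex.I) = ((r * y : ℝ) : ℂ) := by
        rw [Complex.ofReal_mul, ← hr]; ring
      rw [e]
      simpa using hM (r * y)
  have hlim : Tendsto (fun ε : ℝ => ‖Complex.exp (-(ε * z)) * g (σ * z)‖) (𝓝[>] 0)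
      (𝓝 ‖g (σ * z)‖) := by
    have hc : Continuous fun ε : ℝ => ‖Complex.exp (-(ε * z)) * g (σ * z)‖ := by fun_prop
    have := (hc.tendsto 0).mono_left (nhdsWithin_le_nhds (s := Set.Ioi 0))
    simpa using this
  refine le_of_tendsto hlim ?_
  filter_upwards [self_mem_nhdsWithin] with ε h using hε ε h

/-- An entire function of exponential type zero that is bounded on the real axis is constant. -/
theorem exists_eq_const_of_mem_entireExpType_zero {g : ℂ → ℂ} (hg : g ∈ entireExpType 0) :
    ∃ c : ℂ, ∀ z, g z = c := by
  obtain ⟨M, hM⟩ := hg.2.2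
  have hb : ∀ z, ‖g z‖ ≤ M := fun z => by
    rcases le_total 0 z.im with h | h
    · have h1 := norm_le_of_mem_entireExpType_zero hg hM (σ := Complex.I) (by simp)
        ⟨-1, by simp⟩ (z := -Complex.I * z) (by simpa using h)
      rwa [← mul_assoc, mul_neg, Complex.I_mul_I, neg_neg, one_mul] at h1
    · have h1 := norm_le_of_mem_entireExpType_zero hg hM (σ := -Complex.I) (by simp)
        ⟨1, by simp⟩ (z := Complex.I * z) (by simpa using h)
      rwa [← mul_assoc, neg_mul, Complex.I_mul_I, neg_neg, one_mul] at h1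
  refine Differentiable.exists_const_forall_eq_of_bounded hg.1 ?_
  refine isBounded_iff_forall_norm_le.2 ⟨M, ?_⟩
  rintro _ ⟨z, rfl⟩
  exact hb z

theorem integral_norm_le_of_stepanovNorm_le {r : ℝ → ℂ} (hr : AEStronglyMeasurable r volume)
    {ε : ℝ} (hε : 0 ≤ ε) (h : stepanovNorm 1 r ≤ ENNReal.ofReal ε) (u : ℝ) :
    ∫ t in u..(u + Real.pi), ‖r t‖ ≤ Real.pi * ε := by
  have hπ := Real.pi_pos
  rw [intervalIntegral.integral_of_le (by linarith),
    integral_norm_eq_lintegral_enorm hr.restrict]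
  refine ENNReal.toReal_le_of_le_ofReal (by positivity) ?_
  rw [ENNReal.ofReal_mul hπ.le]
  exact (setLIntegral_le_stepanovNorm r u).trans (by gcongr)

theorem stepanovNorm_le_of_bounded {r : ℝ → ℂ} {M : ℝ} (hM : ∀ t, ‖r t‖ ≤ M) :
    stepanovNorm 1 r ≤ ENNReal.ofReal M := by
  have hπ := Real.pi_pos
  refine iSup_le fun u => ?_
  simp only [ENNReal.rpow_one, div_one]
  calc _ ≤ ENNReal.ofReal (1 / Real.pi) *
        ∫⁻ t in Set.Ioc u (u + Real.pi), ENNReal.ofReal M := by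
        gcongr with t
        rw [← ofReal_norm]
        exact ENNReal.ofReal_le_ofReal (hM t)
    _ = _ := by
        rw [setLIntegral_const, Real.volume_Ioc, add_sub_cancel_left, mul_comm, mul_assoc,
          ← ENNReal.ofReal_mul hπ.le, mul_one_div_cancel hπ.ne', ENNReal.ofReal_one, mul_one]

/-- Comparing means gives `|A_0(f) - c| ≤ 2ε`. Averaging `2(c - f(x)) = φ_x(t) - (f(x+t) - c) -
(f(x-t) - c)` over `[0, π]` gives `|c - f(x)| ≤ ε + |C| w(π)/2`. -/
theorem norm_bohrCoeff_zero_sub_le_of_const {α C x : ℝ} (hα : 0 < α) {w : ℝ → ℝ}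
    (hw : IsModulusType w) {f : ℝ → ℂ} (hf : f ∈ omegaClassWith α 1 2 x w C) {c : ℂ} {ε : ℝ}
    (hε : 0 ≤ ε) (h : stepanovNorm 1 (fun t => f t - c) ≤ ENNReal.ofReal ε) :
    ‖bohrCoeff f 0 - f x‖ ≤ |C| * w Real.pi + 3 * ε := by
  have hπ := Real.pi_pos
  obtain ⟨M, hM⟩ := hf.1.2.1
  have hfm := hf.1.1.1
  have hfi : ∀ a b, IntervalIntegrable f volume a b := fun a b =>
    intervalIntegrable_of_bounded hfm hM a b
  have hP : ∀ t, trigPoly {0} (fun _ => c) t = c := fun t => by simp [trigPoly]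
  have h1 : ‖bohrCoeff f 0 - c‖ ≤ 2 * ε := by
    have h2 := (hasMean_bohrCoeff hf.1.1 (hfi 0) 0).norm_sub_le (hasMean_trigPoly {0} (fun _ => c) 0)
      (eventually_norm_mean_sub_le (hfi 0)
        (fun L => (continuous_trigPoly {0} fun _ => c).intervalIntegrable _ _) hε
        (by simpa only [hP] using h) 0)
    simpa using h2
  have hrm : AEStronglyMeasurable (fun t => f t - c) volume := hfm.sub aestronglyMeasurable_const
  have h2 : ∫ t in (0 : ℝ)..Real.pi, ‖f (x + t) - c‖ ≤ Real.pi * ε := by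
    rw [intervalIntegral.integral_comp_add_left (fun t => ‖f t - c‖), add_zero]
    exact integral_norm_le_of_stepanovNorm_le hrm hε h x
  have h3 : ∫ t in (0 : ℝ)..Real.pi, ‖f (x - t) - c‖ ≤ Real.pi * ε := by
    rw [intervalIntegral.integral_comp_sub_left (fun t => ‖f t - c‖), sub_zero]
    have := integral_norm_le_of_stepanovNorm_le hrm hε h (x - Real.pi)
    rwa [sub_add_cancel] at this
  have hctrl := isControlled_secondDiff hα hw hf
  have h4 : ∫ t in (0 : ℝ)..Real.pi, ‖secondDiff f x t‖ ≤ |C| * w Real.pi * Real.pi := by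
    have h5 := hctrl.mean_le (hw.comp_mul (inv_nonneg.2 hα.le)) (abs_nonneg C)
      (D := α * Real.pi) (by positivity)
    have h6 := intervalIntegral.integral_comp_mul_left (a := 0) (b := α * Real.pi)
      (fun t => ‖secondDiff f x t‖) (inv_ne_zero hα.ne')
    simp only [mul_zero, inv_inv, smul_eq_mul, inv_mul_cancel_left₀ hα.ne'] at h5 h6
    rw [h6] at h5
    have h7 : α * ∫ t in (0 : ℝ)..Real.pi, ‖secondDiff f x t‖ ≤
      α * (|C| * w Real.pi * Real.pi) := by linarith
    exact le_of_mul_le_mul_left h7 hα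
  have hi1 : IntervalIntegrable (fun t => ‖f (x + t) - c‖) volume 0 Real.pi :=
    (intervalIntegrable_of_bounded (M := M + ‖c‖)
      ((hfm.comp_measurePreserving (measurePreserving_add_left volume x)).sub
        aestronglyMeasurable_const)
      (fun t => (norm_sub_le _ _).trans (by gcongr; exact hM _)) _ _).norm
  have hi2 : IntervalIntegrable (fun t => ‖f (x - t) - c‖) volume 0 Real.pi :=
    (intervalIntegrable_of_bounded (M := M + ‖c‖)
      ((hfm.comp_measurePreserving (Measure.measurePreserving_sub_left volume x)).sub
        aestronglyMeasurable_const)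
      (fun t => (norm_sub_le _ _).trans (by gcongr; exact hM _)) _ _).norm
  have hi3 : IntervalIntegrable (fun t => ‖secondDiff f x t‖) volume 0 Real.pi := by
    have := (hctrl.intervalIntegrable_norm 0 (α * Real.pi)).comp_mul_left (c := α)
    simpa only [inv_mul_cancel_left₀ hα.ne', zero_div, mul_div_cancel_left₀ _ hα.ne'] using this
  have h5 : ∫ _t in (0 : ℝ)..Real.pi, 2 * ‖c - f x‖ ≤
      Real.pi * ε + Real.pi * ε + |C| * w Real.pi * Real.pi := by
    refine le_trans ?_ (add_le_add (add_le_add h2 h3) h4)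
    rw [← intervalIntegral.integral_add hi1 hi2, ← intervalIntegral.integral_add (hi1.add hi2) hi3]
    refine intervalIntegral.integral_mono_on hπ.le intervalIntegrable_const
      ((hi1.add hi2).add hi3) fun t _ => ?_
    have e : 2 * (c - f x) = secondDiff f x t - (f (x + t) - c) - (f (x - t) - c) := by
      rw [secondDiff]; ring
    calc 2 * ‖c - f x‖ = ‖2 * (c - f x)‖ := by rw [norm_mul, Complex.norm_ofNat]
      _ ≤ ‖secondDiff f x t‖ + ‖f (x + t) - c‖ + ‖f (x - t) - c‖ := by
        rw [e]
        exact (norm_sub_le _ _).trans (add_le_add (norm_sub_le _ _) le_rfl)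
      _ = _ := by ring
  rw [intervalIntegral.integral_const, sub_zero, smul_eq_mul] at h5
  have h6 : 2 * ‖c - f x‖ ≤ ε + ε + |C| * w Real.pi := by
    refine le_of_mul_le_mul_left ?_ hπ
    linarith
  have h7 := norm_sub_le_norm_sub_add_norm_sub (bohrCoeff f 0) c (f x)
  have h8 : 0 ≤ |C| * w Real.pi := mul_nonneg (abs_nonneg C) (hw.nonneg hπ.le)
  linarith

theorem norm_bohrCoeff_zero_sub_le {α C x : ℝ} (hα : 0 < α) {w : ℝ → ℝ}
    (hw : IsModulusType w) {f : ℝ → ℂ} (hf : f ∈ omegaClassWith α 1 2 x w C) :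
    ‖bohrCoeff f 0 - f x‖ ≤ |C| * w Real.pi + 3 * bestApprox 0 1 f := by
  obtain ⟨M, hM⟩ := hf.1.2.1
  set E := ⨅ g ∈ entireExpType 0, stepanovNorm 1 (fun t => f t - g (t : ℂ)) with hE
  -- Boundedness of `f` and the competitor `g = 0` make the infimum finite, so that `toReal` in
  -- `bestApprox` does not collapse it to `0`.
  have hEfin : E ≠ ⊤ := by
    have h0 : (fun _ => 0 : ℂ → ℂ) ∈ entireExpType 0 :=
      ⟨differentiable_const _, fun ε _ => ⟨0, fun z => by simp⟩, 0, fun t => by simp⟩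
    refine ne_top_of_le_ne_top ENNReal.ofReal_ne_top ((iInf₂_le _ h0).trans
      (stepanovNorm_le_of_bounded (M := M) fun t => ?_))
    rw [sub_zero]
    exact hM t
  have hle : ENNReal.ofReal ((‖bohrCoeff f 0 - f x‖ - |C| * w Real.pi) / 3) ≤ E := by
    refine le_iInf₂ fun g hg => ?_
    obtain ⟨c, hc⟩ := exists_eq_const_of_mem_entireExpType_zero hg
    simp only [hc]
    rcases eq_or_ne (stepanovNorm 1 fun t => f t - c) ⊤ with htop | htop
    · rw [htop]; exact le_top
    · have h1 := norm_bohrCoeff_zero_sub_le_of_const hα hw hf ENNReal.toReal_nonneg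
        (ENNReal.ofReal_toReal htop).ge
      rw [ENNReal.ofReal_le_iff_le_toReal htop]
      linarith
  rw [ENNReal.ofReal_le_iff_le_toReal hEfin] at hle
  have : bestApprox 0 1 f = E.toReal := rfl
  rw [this]
  linarith

/-! ### The integral representation and the conclusion. -/

theorem partialSum_zero (f : ℝ → ℂ) (x : ℝ) : partialSum f 0 x = bohrCoeff f 0 := by
  have h1 : partialSum f 0 x =
      ∑ᶠ (l : ℝ) (_ : l ∈ ({0} : Set ℝ)), bohrCoeff f l * Complex.exp (Complex.I * l * x) := by
    simp only [partialSum, abs_nonpos_iff, Set.mem_singleton_iff]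
  rw [h1, finsum_mem_singleton]
  simp

/-- The integral of the kernel absorbs `f(x)`, and folding the line at the origin with the even
kernel produces the symmetric second difference. -/
theorem integral_cosKernel_smul_sub_eq {f : ℝ → ℂ} (hf : AEStronglyMeasurable f volume) {M : ℝ}
    (hM : ∀ t, ‖f t‖ ≤ M) (a b x : ℝ) :
    (∫ t, cosKernel a b t • f (x + t)) - (((|b| - |a|) * cosKernelMass : ℝ) : ℂ) * f x =
      ∫ t in Set.Ioi (0 : ℝ), cosKernel a b t • secondDiff f x t := by
  have hkm := measurable_cosKernel a b
  have hkB := abs_cosKernel_le a b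
  have hi1 : Integrable fun t => cosKernel a b t • f (x + t) :=
    integrable_smul_of_decay (hf.comp_measurePreserving (measurePreserving_add_left volume x))
      (fun t => hM _) hkm hkB
  have hi2 : Integrable fun t => cosKernel a b t • f x :=
    integrable_smul_of_decay aestronglyMeasurable_const (fun _ => hM x) hkm hkB
  set g : ℝ → ℂ := fun t => cosKernel a b t • f (x + t) - cosKernel a b t • f x with hg
  have hgi : Integrable g := hi1.sub hi2
  have h1 : (∫ t, cosKernel a b t • f (x + t)) - (((|b| - |a|) * cosKernelMass : ℝ) : ℂ) * f x =
      ∫ t, g t := by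
    rw [integral_sub hi1 hi2, integral_smul_const, integral_cosKernel, Complex.real_smul]
  have h2 := integral_comp_neg_Ioi (0 : ℝ) g
  rw [neg_zero] at h2
  rw [h1, ← intervalIntegral.integral_Iic_add_Ioi hgi.integrableOn hgi.integrableOn (b := 0), ← h2,
    ← integral_add hgi.comp_neg.integrableOn hgi.integrableOn]
  refine integral_congr_ae (ae_of_all _ fun t => ?_)
  simp only [hg, cosKernel_neg, ← smul_sub, ← smul_add, secondDiff, ← sub_eq_add_neg]
  congr 1
  ring

theorem integral_cosKernel_scale {α : ℝ} (hα : 0 < α) (φ : ℝ → ℂ) (a b : ℝ) :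
    ∫ t in Set.Ioi (0 : ℝ), cosKernel (α * a) (α * b) t • φ t =
      α * ∫ s in Set.Ioi (0 : ℝ), cosKernel a b s • φ (α⁻¹ * s) := by
  have h1 := integral_comp_mul_left_Ioi (fun t => cosKernel (α * a) (α * b) t • φ t) 0
    (inv_pos.2 hα)
  rw [mul_zero, inv_inv] at h1
  have h2 : ∀ s, cosKernel (α * a) (α * b) (α⁻¹ * s) = α ^ 2 * cosKernel a b s := fun s => by
    simp only [cosKernel]
    rw [show α * a * (α⁻¹ * s) = a * s by field_simp, show α * b * (α⁻¹ * s) = b * s by field_simp,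
      mul_pow, inv_pow]
    field_simp
  simp_rw [h2, mul_smul] at h1
  rw [integral_smul] at h1
  have hα' : (α : ℂ) ≠ 0 := by exact_mod_cast hα.ne'
  simp only [Complex.real_smul] at h1 ⊢
  refine mul_left_cancel₀ hα' (h1.symm.trans ?_)
  push_cast
  ring

/-- The slope of the trapezoid has width `α/4` and must avoid all exponents; separation leaves room
for it on at least one side of `αk/2`. The factor `4` is the reciprocal of the slope width after
rescaling by `α`. -/
theorem exists_partialSum_sub_eq {α C x : ℝ} (hα : 0 < α) {w : ℝ → ℝ} {f : ℝ → ℂ}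
    (hf : f ∈ omegaClassWith α 1 2 x w C) {k : ℕ} (hk : 1 ≤ k) :
    ∃ m : ℕ, (m = 2 * k - 1 ∨ m = 2 * k) ∧
      partialSum f (α * k / 2) x - f x = ((4 / cosKernelMass : ℝ) : ℂ) *
        ∫ s in Set.Ioi (0 : ℝ), cosKernel (m / 4) ((m + 1) / 4) s •
          secondDiff f x (α⁻¹ * s) := by
  obtain ⟨M, hM⟩ := hf.1.2.1
  have hsep := hf.1.2.2
  have hk1 : (1 : ℝ) ≤ k := by exact_mod_cast hk
  have hmass := cosKernelMass_pos
  obtain ⟨m, hm, hgap, hγ⟩ : ∃ m : ℕ, (m = 2 * k - 1 ∨ m = 2 * k) ∧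
      (∀ l, bohrCoeff f l ≠ 0 → |l| ≤ α * (m / 4) ∨ α * ((m + 1) / 4) ≤ |l|) ∧
      (∀ l, bohrCoeff f l ≠ 0 → (|l| ≤ α * k / 2 ↔ |l| ≤ α * (m / 4))) := by
    -- An exponent in `(αk/2 - α/4, αk/2]`, positive because `k ≥ 1`, forces the next one beyond
    -- `αk/2 + 3α/4`, so the slope goes to the right (`m = 2k`). Otherwise it goes to the left (`m =
    -- 2k - 1`).
    by_cases hP : ∃ l₀ ∈ fourierExponents f, α * k / 2 - α / 4 < l₀ ∧ l₀ ≤ α * k / 2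
    · obtain ⟨l₀, hl₀, hlo, hhi⟩ := hP
      have hl₀pos : 0 < l₀ := by nlinarith
      have e1 : α * (((2 * k : ℕ) : ℝ) / 4) = α * k / 2 := by push_cast; ring
      have e2 : α * ((((2 * k : ℕ) : ℝ) + 1) / 4) = α * k / 2 + α / 4 := by push_cast; ring
      refine ⟨2 * k, Or.inr rfl, fun l hl => ?_, fun l hl => ?_⟩
      · rw [e1, e2]
        by_contra hcon
        push Not at hcon
        have := hsep l₀ hl₀ |l| (abs_mem_fourierExponents hl) hl₀pos (by linarith)
        linarith
      · rw [e1]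
    · push Not at hP
      have hcast : ((2 * k - 1 : ℕ) : ℝ) = 2 * k - 1 := by
        rw [Nat.cast_sub (by omega)]; push_cast; ring
      have e1 : α * (((2 * k - 1 : ℕ) : ℝ) / 4) = α * k / 2 - α / 4 := by rw [hcast]; ring
      have e2 : α * ((((2 * k - 1 : ℕ) : ℝ) + 1) / 4) = α * k / 2 := by rw [hcast]; ring
      refine ⟨2 * k - 1, Or.inl rfl, fun l hl => ?_, fun l hl => ?_⟩
      · rw [e1, e2]
        rcases le_or_gt |l| (α * k / 2 - α / 4) with h | h
        · exact Or.inl h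
        · exact Or.inr (hP _ (abs_mem_fourierExponents hl) h).le
      · rw [e1]
        refine ⟨fun h => ?_, fun h => by linarith⟩
        by_contra hcon
        exact absurd (hP _ (abs_mem_fourierExponents hl) (not_le.1 hcon)) (not_lt.2 h)
  refine ⟨m, hm, ?_⟩
  have ha : 0 ≤ α * ((m : ℝ) / 4) := by positivity
  have hb : 0 ≤ α * (((m : ℝ) + 1) / 4) := by positivity
  have hab : α * ((m : ℝ) / 4) ≤ α * ((m + 1) / 4) := by gcongr; linarith
  have h1 := integral_cosKernel_smul_eq_partialSum hf.1.1 hM ha hab hgap hγ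
    (finite_setOf_bohrCoeff_ne_zero hα hsep _) x
  have h2 := integral_cosKernel_smul_sub_eq hf.1.1.1 hM (α * (m / 4)) (α * ((m + 1) / 4)) x
  rw [h1, abs_of_nonneg ha, abs_of_nonneg hb, ← mul_sub, integral_cosKernel_scale hα] at h2
  have hα' : (α : ℂ) ≠ 0 := by exact_mod_cast hα.ne'
  have hm' : (cosKernelMass : ℂ) ≠ 0 := by exact_mod_cast hmass.ne'
  have e : α * (((m : ℝ) + 1) / 4) - α * (m / 4) = α / 4 := by ring
  rw [e] at h2
  push_cast at h2 ⊢
  rw [div_mul_eq_mul_div, eq_div_iff hm']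
  refine mul_left_cancel₀ hα' ?_
  linear_combination 4 * h2

theorem sum_range_two_mul (u : ℕ → ℝ) (n : ℕ) :
    ∑ d ∈ Finset.range (2 * n), u d = ∑ i ∈ Finset.range n, (u (2 * i) + u (2 * i + 1)) := by
  induction n with
  | zero => simp
  | succ n ih =>
    rw [mul_add, mul_one, Finset.sum_range_succ, Finset.sum_range_succ, ih, Finset.sum_range_succ,
      add_assoc]

theorem mean_sq_partialSum_sub_le {α C x : ℝ} (hα : 0 < α) {w : ℝ → ℝ} (hw : IsModulusType w)
    {f : ℝ → ℂ} (hf : f ∈ omegaClassWith α 1 2 x w C) {n : ℕ} (hn : 1 ≤ n) :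
    1 / ((n : ℝ) + 1) * ∑ k ∈ Finset.Icc n (2 * n), ‖partialSum f (α * k / 2) x - f x‖ ^ 2 ≤
      (4 / cosKernelMass * 700 * |C| * ⌈α⁻¹⌉₊ * w (Real.pi / (n + 1))) ^ 2 := by
  have hπ := Real.pi_pos
  have hmass := cosKernelMass_pos
  set J : ℕ → ℂ := fun m => ∫ s in Set.Ioi (0 : ℝ),
    cosKernel (m / 4) ((m + 1) / 4) s • secondDiff f x (α⁻¹ * s) with hJ
  have hsum : ∑ d ∈ Finset.range (2 * (n + 1)), ‖J (2 * n - 1 + d)‖ ^ 2 ≤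
      400000 * (n + 1) * (|C| * w (α⁻¹ * (Real.pi / (n + 1)))) ^ 2 :=
    (isControlled_secondDiff hα hw hf).sum_norm_sq_integral_le
      (hw.comp_mul (inv_nonneg.2 hα.le)) (abs_nonneg C) hn
  have hterm : ∀ k : ℕ, 1 ≤ k → ‖partialSum f (α * k / 2) x - f x‖ ^ 2 ≤
      (4 / cosKernelMass) ^ 2 * (‖J (2 * k - 1)‖ ^ 2 + ‖J (2 * k)‖ ^ 2) := fun k hk => by
    -- Which `m` occurs depends on `k` and `f`; bounding by both candidates removes this dependence,
    -- and each index from `2n-1` to `4n` is then used exactly once.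
    obtain ⟨m, hm, h⟩ := exists_partialSum_sub_eq hα hf hk
    rw [h, norm_mul, Complex.norm_real, Real.norm_of_nonneg (by positivity), mul_pow]
    gcongr
    change ‖J m‖ ^ 2 ≤ _
    rcases hm with rfl | rfl
    · exact le_add_of_nonneg_right (sq_nonneg _)
    · exact le_add_of_nonneg_left (sq_nonneg _)
  have hS : ∑ k ∈ Finset.Icc n (2 * n), ‖partialSum f (α * k / 2) x - f x‖ ^ 2 ≤
      (4 / cosKernelMass) ^ 2 *
        (400000 * (n + 1) * (|C| * w (α⁻¹ * (Real.pi / (n + 1)))) ^ 2) := by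
    calc _ ≤ ∑ k ∈ Finset.Icc n (2 * n),
          (4 / cosKernelMass) ^ 2 * (‖J (2 * k - 1)‖ ^ 2 + ‖J (2 * k)‖ ^ 2) :=
          Finset.sum_le_sum fun k hk => hterm k (hn.trans (Finset.mem_Icc.1 hk).1)
      _ = (4 / cosKernelMass) ^ 2 *
          ∑ d ∈ Finset.range (2 * (n + 1)), ‖J (2 * n - 1 + d)‖ ^ 2 := by
          rw [← Finset.mul_sum, sum_range_two_mul, ← Finset.Ico_succ_right_eq_Icc,
            Finset.sum_Ico_eq_sum_range, Order.succ_eq_add_one,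
            show 2 * n + 1 - n = n + 1 by omega]
          congr 1
          refine Finset.sum_congr rfl fun i _ => ?_
          rw [show 2 * (n + i) - 1 = 2 * n - 1 + 2 * i by omega,
            show 2 * (n + i) = 2 * n - 1 + (2 * i + 1) by omega]
      _ ≤ _ := by gcongr
  -- Subadditivity undoes the rescaling by `α`, at the cost of the factor `⌈α⁻¹⌉`.
  have hwα : w (α⁻¹ * (Real.pi / (n + 1))) ≤ ⌈α⁻¹⌉₊ * w (Real.pi / (n + 1)) :=
    hw.le_natCast_mul (by positivity) (by positivity) (by gcongr; exact Nat.le_ceil _)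
  have hw0 := hw.nonneg (a := α⁻¹ * (Real.pi / (n + 1))) (by positivity)
  rw [one_div, inv_mul_le_iff₀ (by positivity)]
  calc _ ≤ (4 / cosKernelMass) ^ 2 *
        (700 ^ 2 * (n + 1) * (|C| * (⌈α⁻¹⌉₊ * w (Real.pi / (n + 1)))) ^ 2) := by
        refine hS.trans ?_
        gcongr
        norm_num
    _ = _ := by ring

/-- The power mean inequality with exponent `2/q ≥ 1`, applied to `a_k^q`. -/
theorem rpow_mean_le_of_mean_sq_le {s : Finset ℕ} (hs : s.Nonempty) {a : ℕ → ℝ}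
    (ha : ∀ k, 0 ≤ a k) {q X : ℝ} (hq : 0 < q) (hq2 : q ≤ 2) (hX : 0 ≤ X)
    (h : 1 / (s.card : ℝ) * ∑ k ∈ s, a k ^ 2 ≤ X ^ 2) :
    (1 / (s.card : ℝ) * ∑ k ∈ s, a k ^ q) ^ (1 / q) ≤ X := by
  have hc : (0 : ℝ) < s.card := by exact_mod_cast hs.card_pos
  have h1 := Real.rpow_arith_mean_le_arith_mean_rpow s (fun _ => 1 / (s.card : ℝ))
    (fun k => a k ^ q) (fun _ _ => by positivity)
    (by rw [Finset.sum_const, nsmul_eq_mul]; field_simp)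
    (fun k _ => Real.rpow_nonneg (ha k) q) (p := 2 / q) ((one_le_div₀ hq).2 hq2)
  rw [← Finset.mul_sum, ← Finset.mul_sum] at h1
  have h2 : ∀ k, (a k ^ q) ^ (2 / q) = a k ^ 2 := fun k => by
    rw [← Real.rpow_mul (ha k), mul_div_cancel₀ _ hq.ne', Real.rpow_two]
  simp_rw [h2] at h1
  set Y := 1 / (s.card : ℝ) * ∑ k ∈ s, a k ^ q with hY
  have hY0 : 0 ≤ Y := mul_nonneg (by positivity)
    (Finset.sum_nonneg fun k _ => Real.rpow_nonneg (ha k) q)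
  have h3 : (Y ^ (1 / q)) ^ 2 ≤ X ^ 2 := by
    rw [← Real.rpow_two, ← Real.rpow_mul hY0, one_div_mul_eq_div]
    exact h1.trans h
  exact (pow_le_pow_iff_left₀ (Real.rpow_nonneg hY0 _) hX two_ne_zero).1 h3

end StepanovAP

theorem proposition4 (α q C : ℝ) (hα : 0 < α) (hq : 0 < q) (hq2 : q ≤ 2) :
    ∃ K : ℝ, 0 < K ∧
      ∀ (x : ℝ) (w : ℝ → ℝ), StepanovAP.IsModulusType w →
      ∀ f ∈ StepanovAP.omegaClassWith α 1 2 x w C, ∀ n : ℕ,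
        (1 / ((n : ℝ) + 1) * ∑ k ∈ Finset.Icc n (2 * n),
            ‖StepanovAP.partialSum f (α * k / 2) x - f x‖ ^ q) ^ (1 / q)
          ≤ K * (w (Real.pi / ((n : ℝ) + 1)) + StepanovAP.bestApprox (α * n / 2) 1 f) := by
  have hmass := StepanovAP.cosKernelMass_pos
  set D : ℝ := 4 / StepanovAP.cosKernelMass * 700 * |C| * ⌈α⁻¹⌉₊ with hD
  have hD0 : 0 ≤ D := by positivity
  have hC0 := abs_nonneg C
  refine ⟨D + |C| + 3, by positivity, fun x w hw f hf n => ?_⟩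
  have hE : 0 ≤ StepanovAP.bestApprox (α * n / 2) 1 f := ENNReal.toReal_nonneg
  have hw0 := hw.nonneg (a := Real.pi / ((n : ℝ) + 1)) (by positivity)
  -- For `n = 0` the only term is `|A_0(f) - f(x)|`, which needs the best approximation. For `n ≥ 1`
  -- the mean-square bound involves `w` alone, and the best approximation enters only as a
  -- nonnegative summand.
  rcases Nat.eq_zero_or_pos n with rfl | hn
  · have h1 := StepanovAP.norm_bohrCoeff_zero_sub_le hα hw hf
    simp only [Nat.cast_zero, mul_zero, zero_div, zero_add, div_one, Finset.Icc_self,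
      Finset.sum_singleton, one_mul, StepanovAP.partialSum_zero] at hE hw0 ⊢
    rw [one_div, Real.rpow_rpow_inv (norm_nonneg _) hq.ne']
    nlinarith [mul_nonneg hD0 hw0, mul_nonneg hD0 hE, mul_nonneg hC0 hE]
  · have hcard : ((Finset.Icc n (2 * n)).card : ℝ) = n + 1 := by
      rw [Nat.card_Icc, show 2 * n + 1 - n = n + 1 by omega]
      push_cast
      rfl
    have h1 := StepanovAP.rpow_mean_le_of_mean_sq_le (s := Finset.Icc n (2 * n))
      (Finset.nonempty_Icc.2 (by omega))
      (a := fun k => ‖StepanovAP.partialSum f (α * k / 2) x - f x‖) (fun _ => norm_nonneg _)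
      hq hq2 (X := D * w (Real.pi / (n + 1))) (mul_nonneg hD0 hw0)
      (by rw [hcard]; exact StepanovAP.mean_sq_partialSum_sub_le hα hw hf hn)
    rw [hcard] at h1
    refine h1.trans ?_
    nlinarith [mul_nonneg hD0 hE, mul_nonneg hC0 hE, mul_nonneg hC0 hw0]
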